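/- Let $D\ge 2$ be an integer, $E_0,\dots,E_D\in\mathbb R$ and $\beta\in\mathbb R$. Let $\mathbb T_N$ be the (finite) set of plane trees on $N$ vertices in which every vertex $v$ has at most $D$ children; $\deg(v)$ denotes the number of children of $v$. Let $\mu_N$ be the Gibbs measure on $\mathbb T_N$, $\mu_N\{T\}=e^{-\beta E(T)}/Z_N$, where $E(T)=\sum_{v}E_{\deg(v)}$ (sum over the vertices of $T$) and $Z_N=\sum_{T\in\mathbb T_N}e^{-\beta E(T)}$. For a finite or infinite plane tree $T$ with at most $D$ children per vertex, let $\pi_nT$ be the subtree of its vertices of height (distance to the root) at most $n$. On the set $\Delta$ of probability vectors $p=(p_0,\dots,p_D)$ with $\sum_i i\,p_i=1$, the function $J(p)=\sum_i p_i\ln p_i+\beta\sum_i p_iE_i$ has a unique minimizer $p^*$, and there are (unique) $C,\rho>0$ with $p^*_i=Ce^{-\beta E_i}\rho^i$ for $i=0,\dots,D$. Put $\sigma=e^{J(p^*)}$. There is a unique probability measure $P_\infty$ on the set of finite or infinite plane trees with at most $D$ children per vertex, with the $\sigma$-algebra generated by the maps $\pi_n$, such that for every $n$ the law of $\pi_nT$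 under $\mu_N$ converges in total variation, as $N\to\infty$, to the law of $\pi_nT$ under $P_\infty$. A tree with law $P_\infty$ is called the limiting tree. For $n\ge0$ let $X_n=(X_{n,1},X_{n,2},\dots)$ be the code of the $n$-th level of the limiting tree: the vertices of height $n$ are enumerated $1,2,\dots,r_n$ in their natural order; for $1\le l\le r_n$, $X_{n,l}$ is the number of the parent of the $l$-th vertex of height $n$ in the enumeration of the vertices of height $n-1$ (and $X_{0,1}=1$ for the root); and $X_{n,l}=0$ for $l>r_n$. A level is a sequence $g=(g_1,g_2,\dots)$ of non-negative integers that consists of a finite non-decreasing sequence of positive integers, none of which occurs more than $D$ times, followed by zeros; $|g|$ is the number of its non-zero entries. For levels $g,g'$ write $g\lhd g'$ if $\max_l g'_l\le|g|$, and then put $E(g,g')=\sum_{i=1}^{|g|}E_{\#\{j:\,g'_j=i\}}$. Then $(X_n)_{n\ge0}$ is a Markov chain, and for every $n\ge 0$, every $g$ with $\mathsf P\{X_n=g\}>0$, and every sequence $g'$ of non-negative integers, \[ \mathsf P\{X_{n+1}=g'\mid X_n=g\}=\begin{cases}\dfrac{|g'|}{|g|}\,e^{-\beta E(g,g')}\rho^{|g'|-|g|}\sigma^{|g|},&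 g'\text{ is a level and } g\lhd g',\\[1ex] 0,&\text{otherwise.}\end{cases} \] -/

import Mathlib

open MeasureTheory ProbabilityTheory Filter

noncomputable section

/-- A plane (rooted, ordered) tree, finite or infinite, in which every vertex has at most `D`
children. A vertex is the list of child numbers along the path from the root to it, so that the
root is `[]` and the children of `v`, from left to right, are `v ++ [0]`, `v ++ [1]`, …. Two plane
trees are isomorphic (as ordered trees) exactly if they have the same set of vertices. -/
@[ext]
structure PlaneTree (D : ℕ) where
  /-- The set of vertices. -/
  verts : Set (List (Fin D))
  root_mem : [] ∈ verts
  parent_mem : ∀ v i, v ++ [i] ∈ verts → v ∈ verts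
  sibling_mem : ∀ v i j, v ++ [i] ∈ verts → j ≤ i → v ++ [j] ∈ verts

namespace PlaneTree

variable {D : ℕ}

/-- The branching number (number of children) of a vertex. -/
def deg (T : PlaneTree D) (v : List (Fin D)) : ℕ :=
  Set.ncard {i : Fin D | v ++ [i] ∈ T.verts}

/-- The neighbourhood of the root of radius `n`: the subtree of all vertices of height at most `n`.
The height of a vertex is the length of its list. -/
def ball (n : ℕ) (T : PlaneTree D) : PlaneTree D where
  verts := {v | v ∈ T.verts ∧ v.length ≤ n}
  root_mem := ⟨T.root_mem, by simp⟩
  parent_mem := by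
    rintro v i ⟨h, hl⟩
    refine ⟨T.parent_mem v i h, ?_⟩
    simp only [List.length_append, List.length_cons, List.length_nil] at hl
    omega
  sibling_mem := by
    rintro v i j ⟨h, hl⟩ hj
    refine ⟨T.sibling_mem v i j h hj, ?_⟩
    simpa using hl

/-- The σ-algebra on the space of trees generated by the events `v ∈ T`. -/
instance : MeasurableSpace (PlaneTree D) :=
  MeasurableSpace.comap PlaneTree.verts inferInstance

theorem measurable_ball (n : ℕ) : Measurable (ball n : PlaneTree D → PlaneTree D) := by
  refine measurable_comap_iff.2 ?_
  rw [measurable_set_iff]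
  intro v
  have h : Measurable (fun T : PlaneTree D => v ∈ T.verts) :=
    measurable_set_iff.1 (comap_measurable PlaneTree.verts) v
  exact h.and measurable_const

theorem take_mem (T : PlaneTree D) {v : List (Fin D)} (hv : v ∈ T.verts) (k : ℕ) :
    v.take k ∈ T.verts := by
  induction v using List.reverseRecOn with
  | nil => simpa using hv
  | append_singleton v i ih =>
    by_cases hk : k ≤ v.length
    · rw [List.take_append_of_le_length hk]
      exact ih (T.parent_mem v i hv)
    · rw [List.take_of_length_le (by simp; omega)]
      exact hv

/-- The set of plane trees on `N` vertices is finite. -/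
theorem finite_order (D N : ℕ) : {T : PlaneTree D | T.verts.encard = N}.Finite := by
  have hfin := (List.finite_length_le (Fin D) N).finite_subsets
  refine Set.Finite.of_finite_image (f := PlaneTree.verts) (hfin.subset ?_)
    (fun T _ T' _ h => PlaneTree.ext h)
  rintro _ ⟨T, hT, rfl⟩ v hv
  have hT : T.verts.encard = N := hT
  have hinj : Set.InjOn (fun k => v.take k) (Finset.range (v.length + 1) : Set ℕ) := by
    intro a ha b hb hab
    have := congrArg List.length hab
    simp only [List.length_take] at this
    simp only [Finset.coe_range, Set.mem_Iio] at ha hb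
    omega
  have h1 : ((fun k => v.take k) '' (Finset.range (v.length + 1) : Set ℕ)).encard ≤ N := by
    rw [← hT]
    refine Set.encard_le_encard ?_
    rintro _ ⟨k, _, rfl⟩
    exact T.take_mem hv k
  rw [hinj.encard_image, Set.encard_coe_eq_coe_finsetCard, Finset.card_range] at h1
  have h2 : v.length + 1 ≤ N := by exact_mod_cast h1
  change v.length ≤ N
  omega

/-- `𝕋_N`: the plane trees on `N` vertices with branching numbers at most `D`. -/
def ofOrder (D N : ℕ) : Finset (PlaneTree D) := (finite_order D N).toFinset

/-- The energy of a (finite) tree: the sum over its vertices `v` of `E (deg v)`. -/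
def energy (E : ℕ → ℝ) (T : PlaneTree D) : ℝ := ∑ᶠ v ∈ T.verts, E (T.deg v)

/-- The partition function `Z_N`. -/
def partitionFunction (D : ℕ) (E : ℕ → ℝ) (β : ℝ) (N : ℕ) : ℝ :=
  ∑ T ∈ ofOrder D N, Real.exp (-β * T.energy E)

/-- The Gibbs measure `μ_N`, which gives mass `exp (-β E(T)) / Z_N` to each tree `T` on `N`
vertices (as a measure on the space of all trees). -/
def gibbs (D : ℕ) (E : ℕ → ℝ) (β : ℝ) (N : ℕ) : Measure (PlaneTree D) :=
  ∑ T ∈ ofOrder D N,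
    ENNReal.ofReal (Real.exp (-β * T.energy E) / partitionFunction D E β N) • Measure.dirac T

open Classical in
/-- The vertices of height `n`, enumerated in their natural order, from left to right (for lists of
equal length this is the lexicographic order). -/
def level (T : PlaneTree D) (n : ℕ) : List (List (Fin D)) :=
  ((List.finite_length_eq (Fin D) n).toFinset.filter (· ∈ T.verts)).sort

/-- The code of the `n`-th level. The `l`-th entry, `l = 0, 1, 2, …`, belongs to the `l`-th vertex
(counted from 0) of the `n`-th level, and is the number (counted from 1) of the parent of this
vertex in the level `n - 1`; it is `0` if there is no such vertex. For the root, the entry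
is `1`. -/
def levelCode (n : ℕ) (T : PlaneTree D) (l : ℕ) : ℕ :=
  match (T.level n)[l]? with
  | none => 0
  | some v => (T.level (n - 1)).idxOf v.dropLast + 1

end PlaneTree

/-- Convergence in total variation of a sequence of (finite) measures. -/
def TendstoInTotalVariation {Ω : Type*} [MeasurableSpace Ω] (μ : ℕ → Measure Ω)
    (ν : Measure Ω) : Prop :=
  ∀ ε > (0 : ℝ), ∀ᶠ N in atTop, ∀ A, MeasurableSet A → |(μ N).real A - ν.real A| ≤ ε

/-- `P` is the law of the limiting random tree: a probability measure on the space of trees such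
that, for every `n`, the law of the neighbourhood of the root of radius `n` under the Gibbs measures
`μ_N` converges in total variation, as `N → ∞`, to the law of this neighbourhood under `P`. -/
structure IsLimitTreeLaw (D : ℕ) (E : ℕ → ℝ) (β : ℝ) (P : Measure (PlaneTree D)) : Prop where
  isProbabilityMeasure : IsProbabilityMeasure P
  tendsto : ∀ n : ℕ, TendstoInTotalVariation
    (fun N => (PlaneTree.gibbs D E β N).map (PlaneTree.ball n)) (P.map (PlaneTree.ball n))

/-- The set `Δ` of probability vectors on `{0, …, D}` of mean one. -/
def meanOneSimplex (D : ℕ) : Set (Fin (D + 1) → ℝ) :=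
  {p | (∀ i, p i ∈ Set.Icc (0 : ℝ) 1) ∧ ∑ i, p i = 1 ∧ ∑ i : Fin (D + 1), (i : ℕ) * p i = 1}

/-- The function `J = -H + β E`, where `H` is the entropy. -/
def freeEnergy (D : ℕ) (E : ℕ → ℝ) (β : ℝ) (p : Fin (D + 1) → ℝ) : ℝ :=
  -(∑ i, Real.negMulLog (p i)) + β * ∑ i : Fin (D + 1), p i * E i

/-- `|g|`: the number of non-zero entries of `g`. -/
def levelSize (g : ℕ → ℕ) : ℕ := Set.ncard {l | g l ≠ 0}

/-- The sequences that are codes of levels of plane trees with branching numbers at most `D`: a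
finite non-decreasing sequence of positive integers, none of which is repeated more than `D` times,
followed by zeros. -/
def IsLevel (D : ℕ) (g : ℕ → ℕ) : Prop :=
  (∃ k, (∀ l, g l ≠ 0 ↔ l < k) ∧ ∀ l l', l ≤ l' → l' < k → g l ≤ g l') ∧
    ∀ i, i ≠ 0 → Set.ncard {j | g j = i} ≤ D

/-- The relation `g ⊲ g'`: no entry of `g'` exceeds `|g|`. -/
def LevelPrecedes (g g' : ℕ → ℕ) : Prop := ∀ l, g' l ≤ levelSize g

/-- The energy induced by the level `g'` at its parent level `g`. -/
def levelEnergy (E : ℕ → ℝ) (g g' : ℕ → ℕ) : ℝ :=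
  ∑ i ∈ Finset.Icc 1 (levelSize g), E (Set.ncard {j | g' j = i})

open Classical in
/-- The transition probability from `g` to `g'`. -/
def levelTransition (D : ℕ) (E : ℕ → ℝ) (β ρ σ : ℝ) (g g' : ℕ → ℕ) : ℝ :=
  if IsLevel D g' ∧ LevelPrecedes g g' then
    (levelSize g' : ℝ) / (levelSize g : ℝ) * Real.exp (-β * levelEnergy E g g') *
      ρ ^ ((levelSize g' : ℤ) - (levelSize g : ℤ)) * σ ^ levelSize g
  else 0

/-- Under `P`, the process `X` is a (discrete, time-homogeneous) Markov chain with transition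
probability `p`: it takes values in a countable set, its next value depends on its past only through
the present value, and `P (X (n+1) = y | X n = x) = p x y`. -/
structure IsMarkovChain {Ω S : Type*} [MeasurableSpace Ω] [MeasurableSpace S] (P : Measure Ω)
    (X : ℕ → Ω → S) (p : S → S → ℝ) : Prop where
  measurable : ∀ n, Measurable (X n)
  countable : ∃ K : Set S, K.Countable ∧ ∀ n, ∀ᵐ ω ∂P, X n ω ∈ K
  markov : ∀ (n : ℕ) (x : ℕ → S) (y : S), P {ω | ∀ i ≤ n, X i ω = x i} ≠ 0 →
    (P[|{ω | ∀ i ≤ n, X i ω = x i}]).real {ω | X (n + 1) ω = y} =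
      (P[|{ω | X n ω = x n}]).real {ω | X (n + 1) ω = y}
  transition : ∀ (n : ℕ) (x y : S), P {ω | X n ω = x} ≠ 0 →
    (P[|{ω | X n ω = x}]).real {ω | X (n + 1) ω = y} = p x y

end

/-! Put `p i = C exp(-β E i) ρ ^ i`, with `C` and `ρ` chosen so that `p` is a probability vector of
mean one (`exists_isCriticalLaw_tiltedWeight`). The degrees in a tree on `N` vertices sum to `N -
1`, so the product of `p (deg v)` over its vertices is `exp(-β E(T))` times a constant depending
only on `N`. The Gibbs measure is therefore a critical Galton–Watson tree conditioned on its size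
(`weight_tiltedWeight`, `gibbs_real_apply`). Gibbs' inequality shows that `p` is the unique
minimizer of `J` and that `J(p) = log C + log ρ`, whence `σ = C ρ`.

Let `F(m, k)` be the total weight of forests with `m` vertices and `k` trees. Kemperman's formula
`mul_forestWeight` expresses it through a random walk, and a local limit theorem gives `F(m, k) ~ k
κ m ^ (-3/2)`. If the part of a tree below height `n` is prescribed, with vertex set `I`, and has
`r` vertices at height `n`, the rest is a forest of `r` trees (`IsExploration.sum_weight`). The
Gibbs probability of this neighbourhood is thus `∏_I p (deg v)` times `F(N - |I|, r) / F(N, 1)`, and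
it tends to `r ∏_I p (deg v)` (`tendsto_gibbs_ball`).

There are finitely many neighbourhoods of each radius, so convergence of each probability is
convergence in total variation. Compactness of the space of trees supplies a limit law, and the
neighbourhood probabilities determine it.

Given the neighbourhood of radius `n`, the code of level `n + 1` is equivalent to the neighbourhood
of radius `n + 1` (`levelCode_eq_iff_ball_eq`). The quotient of the two limiting probabilities is
the claimed transition probability (`ballWeight_succ`). It involves only two consecutive levels, and
this yields the Markov property. -/

open scoped Topology

/-! ### Forest weights, walk weights and Kemperman's formula -/

open Polynomial in
/-- The generating polynomial of the weights `w 0, …, w D`. -/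
noncomputable def weightPoly (w : ℕ → ℝ) (D : ℕ) : Polynomial ℝ :=
  ∑ i ∈ Finset.range (D + 1), C (w i) * X ^ i

/-- The total weight of the plane forests with `m` vertices and `k` trees, where each vertex with
`i` children has weight `w i`, defined by the exploration of the root of the first tree. -/
noncomputable def forestWeight (w : ℕ → ℝ) (D : ℕ) : ℕ → ℕ → ℝ
  | 0, 0 => 1
  | 0, _ + 1 => 0
  | _ + 1, 0 => 0
  | m + 1, k + 1 => ∑ i ∈ Finset.range (D + 1), w i * forestWeight w D m (k + i)

/-- The weight of the walks with `m` steps and total length `m - k`. -/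
noncomputable def walkWeight (w : ℕ → ℝ) (D m k : ℕ) : ℝ :=
  if k ≤ m then (weightPoly w D ^ m).coeff (m - k) else 0

theorem weightPoly_coeff (w : ℕ → ℝ) (D i : ℕ) :
    (weightPoly w D).coeff i = if i ≤ D then w i else 0 := by
  simp [weightPoly, Polynomial.coeff_X_pow]

theorem coeff_mul_eq_sum_of_coeff_eq_zero {D : ℕ} (a q : Polynomial ℝ)
    (ha : ∀ i, D < i → a.coeff i = 0) (r : ℕ) :
    (a * q).coeff r =
      ∑ i ∈ Finset.range (D + 1), a.coeff i * (if i ≤ r then q.coeff (r - i) else 0) := by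
  rw [Polynomial.coeff_mul, Finset.Nat.sum_antidiagonal_eq_sum_range_succ_mk]
  have h1 : ∑ k ∈ Finset.range r.succ, a.coeff k * q.coeff (r - k) =
      ∑ k ∈ Finset.range (D + 1 + r.succ),
        a.coeff k * (if k ≤ r then q.coeff (r - k) else 0) := by
    refine Finset.sum_subset_zero_on_sdiff (fun x hx => ?_) (fun x hx => ?_) (fun x hx => ?_)
    · simp at hx ⊢; omega
    · simp at hx; rw [if_neg (by omega), mul_zero]
    · simp at hx; rw [if_pos (by omega)]
  rw [h1]
  refine (Finset.sum_subset_zero_on_sdiff (fun x hx => ?_) (fun x hx => ?_) (fun x _ => rfl)).symm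
  · simp at hx ⊢; omega
  · simp at hx; rw [ha x (by omega), zero_mul]

/-- Decomposition by the first step of the walk: a coefficient of `f ^ (m + 1) = f * f ^ m`, where
`f` is the weight polynomial. -/
theorem sum_mul_walkWeight (w : ℕ → ℝ) (D m k : ℕ) :
    ∑ i ∈ Finset.range (D + 1), w i * walkWeight w D m (k + i) = walkWeight w D (m + 1) (k + 1) := by
  by_cases hk : k ≤ m
  · rw [walkWeight, if_pos (by omega), pow_succ', coeff_mul_eq_sum_of_coeff_eq_zero (D := D)]
    · refine Finset.sum_congr rfl fun i hi => ?_
      rw [weightPoly_coeff, if_pos (by simp at hi; omega), walkWeight]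
      congr 1
      refine if_congr (by omega) ?_ rfl
      congr 1; omega
    · intro i hi; rw [weightPoly_coeff, if_neg (by omega)]
  · rw [walkWeight, if_neg (by omega)]
    refine Finset.sum_eq_zero fun i _ => ?_
    rw [walkWeight, if_neg (by omega), mul_zero]

/-- By exchangeability, the first of `m + 1` steps with total `m - k` has conditional mean `(m - k)
/ (m + 1)`. Algebraically, coefficients are compared in `(m + 1) X f' f ^ m = X (f ^ (m + 1))'`. -/
theorem sum_index_mul_walkWeight (w : ℕ → ℝ) (D m k : ℕ) :
    (m + 1 : ℝ) * ∑ i ∈ Finset.range (D + 1), i * w i * walkWeight w D m (k + i) =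
      (m - k) * walkWeight w D (m + 1) (k + 1) := by
  by_cases hk : k ≤ m
  · have hd : (m + 1 : ℝ) *
        ((Polynomial.X * Polynomial.derivative (weightPoly w D)) * weightPoly w D ^ m).coeff (m - k) =
        ((m - k : ℕ) : ℝ) * (weightPoly w D ^ (m + 1)).coeff (m - k) := by
      have : Polynomial.C (m + 1 : ℝ) *
          ((Polynomial.X * Polynomial.derivative (weightPoly w D)) * weightPoly w D ^ m) =
          Polynomial.X * Polynomial.derivative (weightPoly w D ^ (m + 1)) := by
        rw [Polynomial.derivative_pow_succ]; ring
      rw [← Polynomial.coeff_C_mul, this]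
      rcases m - k with _ | r
      · simp
      · rw [Polynomial.coeff_X_mul, Polynomial.coeff_derivative]; push_cast; ring
    have hc : ∀ i, (Polynomial.X * Polynomial.derivative (weightPoly w D)).coeff i =
        i * (weightPoly w D).coeff i := by
      rintro (_ | i)
      · simp
      · rw [Polynomial.coeff_X_mul, Polynomial.coeff_derivative]; push_cast; ring
    rw [walkWeight, if_pos (by omega), show m + 1 - (k + 1) = m - k by omega,
      ← Nat.cast_sub hk, ← hd, coeff_mul_eq_sum_of_coeff_eq_zero (D := D)]
    · congr 1
      refine Finset.sum_congr rfl fun i hi => ?_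
      rw [hc, weightPoly_coeff, if_pos (by simp at hi; omega), walkWeight]
      congr 1
      refine if_congr (by omega) ?_ rfl
      congr 1; omega
    · intro i hi; rw [hc, weightPoly_coeff, if_neg (by omega), mul_zero]
  · rw [walkWeight, if_neg (by omega), mul_zero]
    refine mul_eq_zero_of_right _ (Finset.sum_eq_zero fun i _ => ?_)
    rw [walkWeight, if_neg (by omega), mul_zero]

/-- Kemperman's formula. -/
theorem mul_forestWeight (w : ℕ → ℝ) (D m k : ℕ) :
    (m : ℝ) * forestWeight w D m k = k * walkWeight w D m k := by
  induction m generalizing k with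
  | zero =>
    rcases k with _ | k
    · simp
    · simp [walkWeight]
  | succ m ih =>
    rcases k with _ | k
    · simp [forestWeight]
    -- For a single vertex the induction hypothesis carries the factor zero and says nothing, so
    -- this case is computed directly.
    rcases m with _ | m
    · have h := sum_mul_walkWeight w D 0 k
      have h0 : ∀ j, forestWeight w D 0 j = walkWeight w D 0 j := by
        rintro (_ | j) <;> simp [forestWeight, walkWeight]
      rw [forestWeight]
      simp only [h0]
      rw [h]
      rcases k with _ | k
      · simp
      · simp [walkWeight]
    · have hm : ((m : ℝ) + 1) ≠ 0 := by positivity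
      have h1 := sum_mul_walkWeight w D (m + 1) k
      have h2 := sum_index_mul_walkWeight w D (m + 1) k
      -- The factor `k + i` in the induction hypothesis splits into `k` and `i`, which call for the
      -- first and the second walk identity respectively.
      have h3 : ((m : ℝ) + 1) * forestWeight w D (m + 1 + 1) (k + 1) =
          k * (∑ i ∈ Finset.range (D + 1), w i * walkWeight w D (m + 1) (k + i)) +
          ∑ i ∈ Finset.range (D + 1), i * w i * walkWeight w D (m + 1) (k + i) := by
        rw [forestWeight, Finset.mul_sum, Finset.mul_sum, ← Finset.sum_add_distrib]
        refine Finset.sum_congr rfl fun i _ => ?_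
        have := ih (k + i)
        push_cast at this
        linear_combination w i * this
      rw [h1] at h3
      apply mul_left_cancel₀ hm
      push_cast at h2 h3 ⊢
      linear_combination ((m : ℝ) + 1 + 1) * h3 + h2

/-! ### Local limit theorem for the centred walk -/

/-- A probability vector on `{0, …, D}` with mean one and positive weights. -/
structure IsCriticalLaw (w : ℕ → ℝ) (D : ℕ) : Prop where
  pos : ∀ i, 0 < w i
  sum_eq_one : ∑ i ∈ Finset.range (D + 1), w i = 1
  mean_eq_one : ∑ i ∈ Finset.range (D + 1), i * w i = 1

/-- The characteristic function of the step of the centred walk. -/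
noncomputable def stepCharFun (w : ℕ → ℝ) (D : ℕ) (θ : ℝ) : ℂ :=
  ∑ j ∈ Finset.range (D + 1), w j * Complex.exp (((j : ℝ) - 1 : ℝ) * θ * Complex.I)

theorem integral_exp_int_mul_I (n : ℤ) :
    ∫ θ in -Real.pi..Real.pi, Complex.exp (n * θ * Complex.I) =
      if n = 0 then 2 * (Real.pi : ℂ) else 0 := by
  split_ifs with h
  · subst h; simp; ring
  · have hc : (n * Complex.I : ℂ) ≠ 0 := mul_ne_zero (by exact_mod_cast h) Complex.I_ne_zero
    have := integral_exp_mul_complex (a := -Real.pi) (b := Real.pi) hc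
    simp_rw [mul_right_comm _ Complex.I] at this
    rw [this, div_eq_zero_iff]
    left
    rw [sub_eq_zero, Complex.exp_eq_exp_iff_exists_int]
    exact ⟨n, by push_cast; ring⟩

theorem two_pi_mul_coeff (q : Polynomial ℝ) (j : ℕ) :
    2 * (Real.pi : ℂ) * (q.coeff j : ℝ) =
      ∫ θ in -Real.pi..Real.pi, (q.map Complex.ofRealHom).eval (Complex.exp (θ * Complex.I)) *
        Complex.exp (-j * θ * Complex.I) := by
  have h : ∀ θ : ℝ, (q.map Complex.ofRealHom).eval (Complex.exp (θ * Complex.I)) *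
        Complex.exp (-j * θ * Complex.I) = ∑ i ∈ Finset.range (q.natDegree + j + 1),
          (q.coeff i : ℂ) * Complex.exp (((i - j : ℤ) : ℂ) * θ * Complex.I) := by
    intro θ
    rw [Polynomial.eval_eq_sum_range' (n := q.natDegree + j + 1)
      ((Polynomial.natDegree_map_le).trans_lt (by omega)), Finset.sum_mul]
    refine Finset.sum_congr rfl fun i _ => ?_
    rw [Polynomial.coeff_map, ← Complex.exp_nat_mul, mul_assoc, ← Complex.exp_add]
    congr 2
    push_cast; ring
  simp_rw [h]
  rw [intervalIntegral.integral_finsetSum]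
  · simp_rw [intervalIntegral.integral_const_mul, integral_exp_int_mul_I, sub_eq_zero, Nat.cast_inj]
    simp [mul_comm]
  · intro i _
    exact Continuous.intervalIntegrable (by fun_prop) _ _

/-- Fourier inversion. Centring the steps replaces `f(exp(iθ))` by the characteristic function times
`exp(iθ)`, so only the phase `exp(ikθ)` remains. -/
theorem two_pi_mul_walkWeight (w : ℕ → ℝ) {D m k : ℕ} (hk : k ≤ m) :
    2 * (Real.pi : ℂ) * (walkWeight w D m k : ℝ) =
      ∫ θ in -Real.pi..Real.pi, stepCharFun w D θ ^ m * Complex.exp (k * θ * Complex.I) := by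
  rw [walkWeight, if_pos hk, two_pi_mul_coeff]
  refine intervalIntegral.integral_congr fun θ _ => ?_
  have h : ((weightPoly w D ^ m).map Complex.ofRealHom).eval (Complex.exp (θ * Complex.I)) =
      (stepCharFun w D θ * Complex.exp (θ * Complex.I)) ^ m := by
    rw [Polynomial.map_pow, Polynomial.eval_pow]
    congr 1
    simp only [weightPoly, Polynomial.map_sum, Polynomial.eval_finsetSum, stepCharFun,
      Finset.sum_mul]
    refine Finset.sum_congr rfl fun i _ => ?_
    simp only [Polynomial.map_mul, Polynomial.map_C, Polynomial.map_pow, Polynomial.map_X,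
      Polynomial.eval_mul, Polynomial.eval_C, Polynomial.eval_pow, Polynomial.eval_X]
    rw [mul_assoc, ← Complex.exp_add, ← Complex.exp_nat_mul]
    simp only [Complex.ofRealHom_eq_coe]
    congr 2
    push_cast; ring
  rw [h, mul_pow, mul_assoc, ← Complex.exp_nat_mul, ← Complex.exp_add]
  congr 2
  rw [Nat.cast_sub hk]
  ring

namespace IsCriticalLaw

variable {w : ℕ → ℝ} {D : ℕ}

theorem one_le (h : IsCriticalLaw w D) : 1 ≤ D := by
  by_contra hD
  have : D = 0 := by omega
  subst this
  simpa using h.mean_eq_one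

/-- The steps `-1` and `0` both have positive weight, so their two terms already lose `w 0 * w 1 *
(1 - cos θ)` against the triangle inequality. Then `1 - cos θ ≥ 2θ²/π²` and `1 - x ≤ exp(-x)` give a
Gaussian bound on all of `[-π, π]`, which serves as the dominating function in the local limit
theorem. -/
theorem norm_stepCharFun_le (h : IsCriticalLaw w D) {θ : ℝ} (hθ : |θ| ≤ Real.pi) :
    ‖stepCharFun w D θ‖ ≤ Real.exp (-(2 * w 0 * w 1 / Real.pi ^ 2 * θ ^ 2)) := by
  have h0 := h.pos 0
  have h1 := h.pos 1
  obtain ⟨d, rfl⟩ : ∃ d, D = d + 1 := ⟨D - 1, by have := h.one_le; omega⟩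
  have hs := h.sum_eq_one
  rw [Finset.sum_range_succ', Finset.sum_range_succ'] at hs
  have hnn : 0 ≤ ∑ k ∈ Finset.range d, w (k + 1 + 1) := Finset.sum_nonneg fun i _ => (h.pos _).le
  have hle : w 0 + w 1 ≤ 1 := by simp at hs; linarith
  have hcos := Real.cos_le_one_sub_mul_cos_sq hθ
  have hA : ‖(w 1 : ℂ) + w 0 * Complex.exp (-θ * Complex.I)‖ ≤
      w 0 + w 1 - w 0 * w 1 * (1 - Real.cos θ) := by
    have hc := Real.neg_one_le_cos θ
    have hc' := Real.cos_le_one θ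
    have hpos : 0 ≤ w 0 + w 1 - w 0 * w 1 * (1 - Real.cos θ) := by
      nlinarith [mul_pos h0 h1, mul_nonneg h0.le h1.le, sq_nonneg (w 0 - w 1)]
    rw [← abs_of_nonneg hpos, ← sq_le_sq₀ (norm_nonneg _) (abs_nonneg _), sq_abs,
      ← Complex.normSq_eq_norm_sq]
    have he : (w 1 : ℂ) + w 0 * Complex.exp (-θ * Complex.I) =
        ⟨w 1 + w 0 * Real.cos θ, -(w 0 * Real.sin θ)⟩ := by
      rw [← Complex.ofReal_neg, Complex.exp_mul_I, ← Complex.ofReal_cos, ← Complex.ofReal_sin,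
        Real.cos_neg, Real.sin_neg]
      apply Complex.ext <;> simp [-Complex.ofReal_cos, -Complex.ofReal_sin]
    rw [he, Complex.normSq_mk]
    have hsc := Real.sin_sq_add_cos_sq θ
    have hu : 0 ≤ w 0 * w 1 * (1 - Real.cos θ) :=
      mul_nonneg (mul_nonneg h0.le h1.le) (sub_nonneg.2 hc')
    -- With `s = w 0 + w 1 ≤ 1` and `u = w 0 * w 1 * (1 - cos θ)`: `s² - 2u ≤ s² - 2su + u² = (s -
    -- u)²`.
    calc _ = (w 0 + w 1) ^ 2 - 2 * (w 0 * w 1 * (1 - Real.cos θ)) := by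
          linear_combination (w 0) ^ 2 * hsc
      _ ≤ _ := by
          nlinarith [mul_nonneg hu (sub_nonneg.2 hle), sq_nonneg (w 0 * w 1 * (1 - Real.cos θ))]
  have hB : ‖stepCharFun w (d + 1) θ‖ ≤
      ‖(w 1 : ℂ) + w 0 * Complex.exp (-θ * Complex.I)‖ + ∑ k ∈ Finset.range d, w (k + 1 + 1) := by
    rw [stepCharFun, Finset.sum_range_succ', Finset.sum_range_succ', add_assoc, add_comm]
    refine (norm_add_le _ _).trans (add_le_add (le_of_eq ?_) ?_)
    · congr 1; simp
    · refine norm_sum_le_of_le _ fun i _ => ?_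
      rw [norm_mul, ← Complex.ofReal_mul, Complex.norm_exp_ofReal_mul_I, mul_one,
        Complex.norm_real, Real.norm_of_nonneg (h.pos _).le]
  have hC := Real.add_one_le_exp (-(2 * w 0 * w 1 / Real.pi ^ 2 * θ ^ 2))
  have hD : w 0 * w 1 * (2 / Real.pi ^ 2 * θ ^ 2) ≤ w 0 * w 1 * (1 - Real.cos θ) :=
    mul_le_mul_of_nonneg_left (by linarith) (mul_pos h0 h1).le
  simp only [zero_add] at hs
  have e : 2 * w 0 * w 1 / Real.pi ^ 2 * θ ^ 2 = w 0 * w 1 * (2 / Real.pi ^ 2 * θ ^ 2) := by ring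
  rw [e] at hC ⊢
  linarith

/-- The variance of the step of the centred walk. -/
noncomputable def _root_.stepVariance (w : ℕ → ℝ) (D : ℕ) : ℝ :=
  ∑ j ∈ Finset.range (D + 1), w j * ((j : ℝ) - 1) ^ 2

theorem stepVariance_pos (h : IsCriticalLaw w D) : 0 < stepVariance w D := by
  refine Finset.sum_pos' (fun i _ => mul_nonneg (h.pos i).le (sq_nonneg _)) ⟨0, by simp, ?_⟩
  simpa using h.pos 0

end IsCriticalLaw

/-- Taylor expansion to second order: the cubic remainder, multiplied by `n`, is of order `1 / √n`.
-/
theorem tendsto_nat_mul_exp_sub (a x : ℝ) :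
    Tendsto (fun n : ℕ => (n : ℂ) * (Complex.exp (a * ((x / √n : ℝ) : ℂ) * Complex.I) - 1 -
      a * ((x / √n : ℝ) : ℂ) * Complex.I)) atTop (𝓝 (-(a ^ 2 * x ^ 2 / 2 : ℝ))) := by
  have hlim : Tendsto (fun n : ℕ => (|a * x| ^ 3 * Real.exp |a * x|) / √n) atTop (𝓝 0) :=
    Tendsto.div_atTop tendsto_const_nhds
      (Real.tendsto_sqrt_atTop.comp tendsto_natCast_atTop_atTop)
  rw [tendsto_iff_norm_sub_tendsto_zero]
  refine squeeze_zero' (Eventually.of_forall fun _ => norm_nonneg _) ?_ hlim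
  filter_upwards [eventually_ge_atTop 1] with n hn
  have hn' : (1 : ℝ) ≤ √n := by rw [Real.one_le_sqrt]; exact_mod_cast hn
  have hsq : √(n : ℝ) ^ 2 = n := Real.sq_sqrt (by positivity)
  set s := √(n : ℝ) with hs
  have hs0 : (s : ℂ) ≠ 0 := by exact_mod_cast (by linarith : s ≠ 0)
  have hnc : (n : ℂ) = (s : ℂ) ^ 2 := by rw [← Complex.ofReal_pow, hsq]; simp
  have hb := Complex.norm_exp_sub_sum_le_norm_mul_exp (a * ((x / s : ℝ) : ℂ) * Complex.I) 3
  have hnorm : ‖(a * ((x / s : ℝ) : ℂ) * Complex.I : ℂ)‖ = |a * x| / s := by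
    rw [norm_mul, Complex.norm_I, mul_one, ← Complex.ofReal_mul, Complex.norm_real,
      Real.norm_eq_abs, mul_div_assoc', abs_div, abs_of_pos (by linarith : 0 < s)]
  rw [hnorm] at hb
  have he : (n : ℂ) * (Complex.exp (a * ((x / s : ℝ) : ℂ) * Complex.I) - 1 -
      a * ((x / s : ℝ) : ℂ) * Complex.I) - ((-(a ^ 2 * x ^ 2 / 2) : ℝ) : ℂ) =
      n * (Complex.exp (a * ((x / s : ℝ) : ℂ) * Complex.I) -
        ∑ m ∈ Finset.range 3, (a * ((x / s : ℝ) : ℂ) * Complex.I) ^ m / m.factorial) := by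
    simp [Finset.sum_range_succ, mul_pow, hnc]
    field_simp
    ring
  rw [← Complex.ofReal_neg, he, norm_mul, Complex.norm_natCast]
  have hle : |a * x| / s ≤ |a * x| := div_le_self (abs_nonneg _) hn'
  calc (n : ℝ) * _ ≤ n * ((|a * x| / s) ^ 3 * Real.exp |a * x|) := by
        gcongr
        exact hb.trans (by gcongr)
    _ = _ := by rw [← hsq]; field_simp

namespace IsCriticalLaw

variable {w : ℕ → ℝ} {D : ℕ}

/-- The central limit theorem: mean one cancels the linear term of each expansion, so `n (φ(x/√n) -
1)` tends to minus half the variance times `x²`, and `(1 + z_n / n) ^ n` tends to `exp z`. -/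
theorem tendsto_stepCharFun_pow (h : IsCriticalLaw w D) (x : ℝ) :
    Tendsto (fun n : ℕ => stepCharFun w D (x / √n) ^ n) atTop
      (𝓝 (Real.exp (-(stepVariance w D / 2) * x ^ 2) : ℝ)) := by
  have h1 : ∀ θ : ℝ, stepCharFun w D θ - 1 = ∑ j ∈ Finset.range (D + 1), (w j : ℂ) *
      (Complex.exp (((j : ℝ) - 1 : ℝ) * θ * Complex.I) - 1 - ((j : ℝ) - 1 : ℝ) * θ * Complex.I) := by
    intro θ
    have e1 : ∑ j ∈ Finset.range (D + 1), (w j : ℂ) = 1 := by exact_mod_cast h.sum_eq_one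
    have e2 : ∑ j ∈ Finset.range (D + 1), (j * w j : ℂ) = 1 := by exact_mod_cast h.mean_eq_one
    have e3 : ∑ j ∈ Finset.range (D + 1), (w j : ℂ) * (((j : ℝ) - 1 : ℝ) * θ * Complex.I) = 0 := by
      calc _ = (∑ j ∈ Finset.range (D + 1), (j * w j : ℂ) -
            ∑ j ∈ Finset.range (D + 1), (w j : ℂ)) * (θ * Complex.I) := by
            rw [← Finset.sum_sub_distrib, Finset.sum_mul]
            refine Finset.sum_congr rfl fun j _ => ?_
            push_cast; ring
        _ = 0 := by rw [e1, e2]; simp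
    simp_rw [mul_sub, Finset.sum_sub_distrib, e3, mul_one, e1]
    rw [stepCharFun, sub_zero]
  have h2 : Tendsto (fun n : ℕ => (n : ℂ) * (stepCharFun w D (x / √n) - 1)) atTop
      (𝓝 ((-(stepVariance w D / 2) * x ^ 2 : ℝ) : ℂ)) := by
    simp_rw [h1, Finset.mul_sum]
    have : ((-(stepVariance w D / 2) * x ^ 2 : ℝ) : ℂ) = ∑ j ∈ Finset.range (D + 1),
        (w j : ℂ) * (-(((j : ℝ) - 1) ^ 2 * x ^ 2 / 2 : ℝ)) := by
      rw [stepVariance]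
      push_cast
      rw [Finset.sum_div, neg_mul, Finset.sum_mul, ← Finset.sum_neg_distrib]
      refine Finset.sum_congr rfl fun j _ => ?_
      ring
    rw [this]
    refine tendsto_finsetSum _ fun j _ => ?_
    refine ((tendsto_nat_mul_exp_sub ((j : ℝ) - 1) x).const_mul (w j : ℂ)).congr fun n => ?_
    ring
  have h3 := Complex.tendsto_one_add_pow_exp_of_tendsto h2
  rw [← Complex.ofReal_exp] at h3
  exact h3.congr fun n => by ring

/-- Substitute `θ = x / √m` in the inversion formula and apply dominated convergence to get a
Gaussian integral. The phase `exp(ikx/√m)` tends to one, so the limit does not depend on `k`. -/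
theorem tendsto_sqrt_mul_walkWeight (h : IsCriticalLaw w D) (k : ℕ) :
    Tendsto (fun m : ℕ => √m * walkWeight w D m k) atTop
      (𝓝 (√(Real.pi / (stepVariance w D / 2)) / (2 * Real.pi))) := by
  have hv := h.stepVariance_pos
  set c := 2 * w 0 * w 1 / Real.pi ^ 2 with hc
  have hc0 : 0 < c := by have := h.pos 0; have := h.pos 1; positivity
  -- The rescaled integrand, extended by zero so that all integrals run over the whole line.
  let G : ℕ → ℝ → ℂ := fun m x => Set.indicator (Set.Ioc (-Real.pi * √m) (Real.pi * √m))
    (fun x => stepCharFun w D (x / √m) ^ m * Complex.exp (k * (x / √m : ℝ) * Complex.I)) x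
  have hcont : Continuous (stepCharFun w D) := by unfold stepCharFun; fun_prop
  have hG : Tendsto (fun m => ∫ x, G m x) atTop
      (𝓝 (∫ x : ℝ, ((Real.exp (-(stepVariance w D / 2) * x ^ 2) : ℝ) : ℂ))) := by
    refine tendsto_integral_filter_of_dominated_convergence (fun x => Real.exp (-c * x ^ 2))
      ?_ ?_ (integrable_exp_neg_mul_sq hc0) ?_
    · refine Eventually.of_forall fun m => AEStronglyMeasurable.indicator ?_ measurableSet_Ioc
      exact Continuous.aestronglyMeasurable (by fun_prop)
    · filter_upwards [eventually_ge_atTop 1] with m hm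
      refine ae_of_all _ fun x => ?_
      have hs : 0 < √(m : ℝ) := Real.sqrt_pos.2 (by exact_mod_cast hm)
      have hsq : √(m : ℝ) ^ 2 = m := Real.sq_sqrt (by positivity)
      by_cases hx : x ∈ Set.Ioc (-Real.pi * √m) (Real.pi * √m)
      · simp only [G]
        rw [Set.indicator_of_mem hx, norm_mul, norm_pow, ← Complex.ofReal_natCast,
          ← Complex.ofReal_mul, Complex.norm_exp_ofReal_mul_I, mul_one]
        have hθ : |x / √m| ≤ Real.pi := by
          rw [abs_div, abs_of_pos hs, div_le_iff₀ hs, abs_le]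
          exact ⟨by linarith [hx.1], hx.2⟩
        refine (pow_le_pow_left₀ (norm_nonneg _) (h.norm_stepCharFun_le hθ) m).trans (le_of_eq ?_)
        rw [← Real.exp_nat_mul, ← hc, div_pow, hsq]
        congr 1
        have : (m : ℝ) ≠ 0 := by positivity
        field_simp
      · simp only [G]
        rw [Set.indicator_of_notMem hx, norm_zero]
        positivity
    · refine ae_of_all _ fun x => ?_
      have h1 := h.tendsto_stepCharFun_pow x
      have h2 : Tendsto (fun m : ℕ => Complex.exp (k * (x / √m : ℝ) * Complex.I)) atTop (𝓝 1) := by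
        have h0 : Tendsto (fun m : ℕ => x / √m) atTop (𝓝 0) :=
          Tendsto.div_atTop tendsto_const_nhds
            (Real.tendsto_sqrt_atTop.comp tendsto_natCast_atTop_atTop)
        have hf : Continuous fun y : ℝ => Complex.exp (k * (y : ℂ) * Complex.I) := by fun_prop
        have := (hf.tendsto 0).comp h0
        simpa [Function.comp_def] using this
      have h3 := h1.mul h2
      rw [mul_one] at h3
      refine h3.congr' ?_
      have hlarge : Tendsto (fun m : ℕ => Real.pi * √m) atTop atTop :=
        (Real.tendsto_sqrt_atTop.comp tendsto_natCast_atTop_atTop).const_mul_atTop Real.pi_pos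
      filter_upwards [hlarge.eventually_gt_atTop |x|] with m hm
      rw [abs_lt] at hm
      simp only [G]
      rw [Set.indicator_of_mem]
      exact ⟨by linarith, hm.2.le⟩
  have hkey : ∀ᶠ m : ℕ in atTop, ∫ x, G m x = ((√m * walkWeight w D m k * (2 * Real.pi) : ℝ) : ℂ) := by
    filter_upwards [eventually_ge_atTop (k + 1)] with m hm
    have hs : 0 < √(m : ℝ) := Real.sqrt_pos.2 (by exact_mod_cast (by omega : 0 < m))
    have h1 := two_pi_mul_walkWeight w (D := D) (by omega : k ≤ m)
    simp only [G]
    rw [integral_indicator measurableSet_Ioc, ← intervalIntegral.integral_of_le (by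
      have := Real.pi_pos; nlinarith)]
    rw [intervalIntegral.integral_comp_div
      (f := fun y => stepCharFun w D y ^ m * Complex.exp (k * (y : ℝ) * Complex.I)) hs.ne',
      mul_div_cancel_right₀ _ hs.ne', mul_div_cancel_right₀ _ hs.ne', ← h1]
    rw [Complex.real_smul]
    push_cast; ring
  have hlim := hG.congr' hkey
  rw [integral_complex_ofReal, integral_gaussian] at hlim
  have hre := (Complex.continuous_re.tendsto _).comp hlim
  simp only [Function.comp_def, Complex.ofReal_re] at hre
  have hdiv := hre.div_const (2 * Real.pi)
  refine hdiv.congr fun m => ?_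
  field_simp [Real.pi_pos.ne']

end IsCriticalLaw

/-! ### Asymptotics of the forest weights -/

namespace IsCriticalLaw

variable {w : ℕ → ℝ} {D : ℕ}

theorem exists_tendsto_forestWeight (h : IsCriticalLaw w D) :
    ∃ κ > 0, ∀ k : ℕ, Tendsto (fun m : ℕ => √m * m * forestWeight w D m k) atTop (𝓝 (k * κ)) := by
  have hv := h.stepVariance_pos
  have hpi := Real.pi_pos
  refine ⟨√(Real.pi / (stepVariance w D / 2)) / (2 * Real.pi), by positivity, fun k => ?_⟩
  refine ((h.tendsto_sqrt_mul_walkWeight k).const_mul (k : ℝ)).congr fun m => ?_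
  rw [mul_assoc √(m : ℝ), mul_forestWeight]
  ring

theorem eventually_forestWeight_pos (h : IsCriticalLaw w D) :
    ∀ᶠ m in atTop, 0 < forestWeight w D m 1 := by
  obtain ⟨κ, hκ, hlim⟩ := h.exists_tendsto_forestWeight
  filter_upwards [(hlim 1).eventually_const_lt (by simpa using hκ : (0 : ℝ) < (1 : ℕ) * κ)] with m hm
  by_contra hneg
  have : √(m : ℝ) * m * forestWeight w D m 1 ≤ 0 :=
    mul_nonpos_of_nonneg_of_nonpos (by positivity) (not_lt.1 hneg)
  linarith

/-- The constant `κ` and the power `m ^ (-3/2)` cancel, and the shift by `r` does not matter; only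
the linear dependence on the number of trees survives. -/
theorem tendsto_forestWeight_div (h : IsCriticalLaw w D) (k r : ℕ) :
    Tendsto (fun m => forestWeight w D m k / forestWeight w D (m + r) 1) atTop (𝓝 k) := by
  obtain ⟨κ, hκ, hlim⟩ := h.exists_tendsto_forestWeight
  have h1 := (tendsto_add_atTop_iff_nat r).2 (hlim 1)
  have h2 : Tendsto (fun m : ℕ => ((m + r : ℕ) : ℝ) / m) atTop (𝓝 1) := by
    have : Tendsto (fun m : ℕ => 1 + (r : ℝ) / m) atTop (𝓝 (1 + 0)) :=
      tendsto_const_nhds.add (tendsto_const_nhds.div_atTop tendsto_natCast_atTop_atTop)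
    rw [add_zero] at this
    refine this.congr' ?_
    filter_upwards [eventually_gt_atTop 0] with m hm
    have : (m : ℝ) ≠ 0 := by positivity
    push_cast
    field_simp
  have h3 := ((hlim k).div h1 (by simpa using hκ.ne')).mul
    (((Real.continuous_sqrt.tendsto 1).comp h2).mul h2)
  rw [Nat.cast_one, one_mul, mul_div_cancel_right₀ _ hκ.ne', Real.sqrt_one, mul_one, mul_one] at h3
  refine h3.congr' ?_
  filter_upwards [eventually_gt_atTop 0] with m hm
  have h4 : (0 : ℝ) < m := by exact_mod_cast hm
  have h5 : (0 : ℝ) < ((m + r : ℕ) : ℝ) := by positivity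
  have h6 := Real.sqrt_pos.2 h4
  have h7 := Real.sqrt_pos.2 h5
  simp only [Pi.div_apply, Function.comp_apply]
  rw [Real.sqrt_div h5.le]
  by_cases h8 : forestWeight w D (m + r) 1 = 0
  · simp [h8]
  · field_simp

end IsCriticalLaw

/-! ### The critical exponential tilt minimizes the free energy -/

section Entropy

variable {D : ℕ}

/-- The exponential family `C exp (-β E i) ρ ^ i`. -/
noncomputable def tiltedWeight (E : ℕ → ℝ) (β C ρ : ℝ) (i : ℕ) : ℝ := C * Real.exp (-β * E i) * ρ ^ i

/-- Mean one amounts to `∑ (i - 1) a i ρ ^ i = 0` with `a i = exp(-β E i)`. This polynomial is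
negative at zero and positive for large `ρ`, because `D ≥ 2` provides a positive term. The constant
`C` then normalizes. -/
theorem exists_isCriticalLaw_tiltedWeight (hD : 2 ≤ D) (E : ℕ → ℝ) (β : ℝ) :
    ∃ C ρ : ℝ, 0 < C ∧ 0 < ρ ∧ IsCriticalLaw (tiltedWeight E β C ρ) D := by
  set a : ℕ → ℝ := fun i => Real.exp (-β * E i) with ha
  have ha0 : ∀ i, 0 < a i := fun i => Real.exp_pos _
  let f : ℝ → ℝ := fun x => ∑ i ∈ Finset.range (D + 1), ((i : ℝ) - 1) * a i * x ^ i
  have hf : Continuous f := by fun_prop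
  -- Chosen so that `a 2 * R ^ 2 ≥ a 2 * R > a 0`: the quadratic term alone outweighs the only
  -- negative one.
  set R := a 0 / a 2 + 1 with hR
  have hR1 : 1 ≤ R := by have := div_pos (ha0 0) (ha0 2); linarith
  obtain ⟨d, rfl⟩ : ∃ d, D = d + 2 := ⟨D - 2, by omega⟩
  have hsplit : ∀ x, f x = ∑ i ∈ Finset.range d, ((i : ℝ) + 2) * a (i + 3) * x ^ (i + 3) +
      a 2 * x ^ 2 - a 0 := by
    intro x
    simp only [f]
    rw [Finset.sum_range_succ', Finset.sum_range_succ', Finset.sum_range_succ']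
    have : ∀ i : ℕ, (((i + 1 + 1 + 1 : ℕ) : ℝ) - 1) = i + 2 := fun i => by push_cast; ring
    simp only [this]
    norm_num
    ring
  have hf0 : f 0 < 0 := by rw [hsplit]; simp [ha0 0]
  have hfR : 0 < f R := by
    rw [hsplit]
    have h1 : 0 ≤ ∑ i ∈ Finset.range d, ((i : ℝ) + 2) * a (i + 3) * R ^ (i + 3) :=
      Finset.sum_nonneg fun i _ => by have := ha0 (i + 3); positivity
    have h2 : a 0 < a 2 * R := by
      rw [hR, mul_add, mul_div_cancel₀ _ (ha0 2).ne']; linarith [ha0 2]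
    have h3 : a 2 * R ≤ a 2 * R ^ 2 := by
      have := ha0 2
      gcongr
      nlinarith
    linarith
  obtain ⟨ρ, hρ, hfρ⟩ := intermediate_value_Icc (by linarith : (0 : ℝ) ≤ R) hf.continuousOn
    (show (0 : ℝ) ∈ Set.Icc (f 0) (f R) from ⟨hf0.le, hfR.le⟩)
  have hρ0 : 0 < ρ := by
    rcases hρ.1.lt_or_eq with h | h
    · exact h
    · rw [← h] at hfρ; linarith
  set S := ∑ i ∈ Finset.range (d + 2 + 1), a i * ρ ^ i with hS
  have hS0 : 0 < S := Finset.sum_pos (fun i _ => mul_pos (ha0 i) (pow_pos hρ0 i)) (by simp)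
  have hsum : ∑ i ∈ Finset.range (d + 2 + 1), tiltedWeight E β S⁻¹ ρ i = 1 := by
    simp only [tiltedWeight, mul_assoc]
    rw [← Finset.mul_sum]
    exact inv_mul_cancel₀ hS0.ne'
  refine ⟨S⁻¹, ρ, by positivity, hρ0, fun i => ?_, hsum, ?_⟩
  · exact mul_pos (mul_pos (by positivity) (Real.exp_pos _)) (pow_pos hρ0 i)
  · have : ∑ i ∈ Finset.range (d + 2 + 1), (i : ℝ) * tiltedWeight E β S⁻¹ ρ i - 1 = S⁻¹ * f ρ := by
      rw [← hsum]
      rw [← Finset.sum_sub_distrib, Finset.mul_sum]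
      refine Finset.sum_congr rfl fun i _ => ?_
      simp only [tiltedWeight, ha]
      ring
    rw [hfρ, mul_zero] at this
    linarith

variable {E : ℕ → ℝ} {β C ρ : ℝ}

theorem IsCriticalLaw.mem_meanOneSimplex {w : ℕ → ℝ} (h : IsCriticalLaw w D) :
    (fun i : Fin (D + 1) => w i) ∈ meanOneSimplex D := by
  have hs := h.sum_eq_one
  have hm := h.mean_eq_one
  rw [Finset.sum_range] at hs hm
  refine ⟨fun i => ⟨(h.pos i).le, ?_⟩, hs, hm⟩
  rw [← hs]
  exact Finset.single_le_sum (f := fun i : Fin (D + 1) => w i) (fun j _ => (h.pos j).le)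
    (Finset.mem_univ i)

/-- Up to `-β E i`, the logarithm of the weight is affine in `i`, so the two linear constraints on
`q` fix its average. -/
theorem sum_mul_log_tiltedWeight_add (hC : 0 < C) (hρ : 0 < ρ) {q : Fin (D + 1) → ℝ}
    (hq : q ∈ meanOneSimplex D) :
    ∑ i : Fin (D + 1), q i * Real.log (tiltedWeight E β C ρ i) + β * ∑ i : Fin (D + 1), q i * E i =
      Real.log C + Real.log ρ := by
  have h1 : ∀ i : Fin (D + 1), q i * Real.log (tiltedWeight E β C ρ i) =
      Real.log C * q i - β * (q i * E i) + Real.log ρ * ((i : ℕ) * q i) := by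
    intro i
    rw [tiltedWeight, Real.log_mul (by positivity) (by positivity),
      Real.log_mul (by positivity) (by positivity), Real.log_exp, Real.log_pow]
    ring
  simp only [h1, Finset.sum_add_distrib, Finset.sum_sub_distrib, ← Finset.mul_sum]
  rw [hq.2.1, hq.2.2]
  ring

theorem freeEnergy_tiltedWeight (hC : 0 < C) (hρ : 0 < ρ)
    (h : IsCriticalLaw (tiltedWeight E β C ρ) D) :
    freeEnergy D E β (fun i => tiltedWeight E β C ρ i) = Real.log C + Real.log ρ := by
  rw [← sum_mul_log_tiltedWeight_add (E := E) (β := β) hC hρ h.mem_meanOneSimplex, freeEnergy]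
  simp [Real.negMulLog]

/-- The strict inequality `log x < x - 1` at `x = p / q`; for `q = 0` the logarithmic terms vanish.
-/
theorem mul_log_sub_log_gt {p q : ℝ} (hp : 0 < p) (hq : 0 ≤ q) (hne : q ≠ p) :
    q - p < q * Real.log q - q * Real.log p := by
  rcases hq.eq_or_lt with rfl | hq
  · simpa using hp
  · have h1 := Real.log_lt_sub_one_of_pos (div_pos hp hq) (by
      rw [Ne, div_eq_one_iff_eq hq.ne']; exact fun h => hne h.symm)
    rw [Real.log_div hp.ne' hq.ne'] at h1
    have h2 := mul_lt_mul_of_pos_left h1 hq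
    have h3 : q * (p / q - 1) = p - q := by field_simp
    rw [h3] at h2
    linarith

/-- Gibbs' inequality: the difference of the two free energies is the relative entropy `∑ q log (q /
p)`. -/
theorem freeEnergy_tiltedWeight_lt (hC : 0 < C) (hρ : 0 < ρ)
    (h : IsCriticalLaw (tiltedWeight E β C ρ) D) {q : Fin (D + 1) → ℝ}
    (hq : q ∈ meanOneSimplex D) (hne : q ≠ fun i : Fin (D + 1) => tiltedWeight E β C ρ i) :
    freeEnergy D E β (fun i => tiltedWeight E β C ρ i) < freeEnergy D E β q := by
  rw [freeEnergy_tiltedWeight hC hρ h, ← sum_mul_log_tiltedWeight_add (E := E) (β := β) hC hρ hq,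
    freeEnergy]
  refine add_lt_add_left ?_ _
  obtain ⟨j, hj⟩ := Function.ne_iff.1 hne
  have hlt : ∑ i, (q i - tiltedWeight E β C ρ i) <
      ∑ i, (q i * Real.log (q i) - q i * Real.log (tiltedWeight E β C ρ i)) := by
    refine Finset.sum_lt_sum (fun i _ => ?_)
      ⟨j, Finset.mem_univ j, mul_log_sub_log_gt (h.pos j) (hq.1 j).1 hj⟩
    by_cases hi : q i = tiltedWeight E β C ρ i
    · rw [hi]; simp
    · exact (mul_log_sub_log_gt (h.pos i) (hq.1 i).1 hi).le
  rw [Finset.sum_sub_distrib, Finset.sum_sub_distrib, hq.2.1, h.mem_meanOneSimplex.2.1] at hlt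
  simp only [Real.negMulLog, neg_mul, Finset.sum_neg_distrib, neg_neg]
  linarith

end Entropy

/-! ### Exploration of trees and the weight of their completions -/

namespace PlaneTree

variable {D : ℕ}

/-- An initial segment of `Fin D` is determined by its size; hence the degree of a vertex determines
its set of children. -/
theorem setOf_lt_of_lower {s : Set (Fin D)} (hs : ∀ i j, i ∈ s → j ≤ i → j ∈ s) (i : Fin D) :
    i ∈ s ↔ (i : ℕ) < s.ncard := by
  classical
  constructor
  · intro hi
    have : (Finset.Iic i : Set (Fin D)) ⊆ s := fun j hj => hs i j hi (by simpa using hj)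
    have := Set.ncard_le_ncard this s.toFinite
    rw [Set.ncard_coe_finset, Fin.card_Iic] at this
    omega
  · intro hi
    by_contra hn
    have : s ⊆ (Finset.Iio i : Set (Fin D)) := by
      intro j hj
      simp only [Finset.coe_Iio, Set.mem_Iio]
      by_contra hji
      exact hn (hs j i hj (not_lt.1 hji))
    have := Set.ncard_le_ncard this (Set.toFinite _)
    rw [Set.ncard_coe_finset, Fin.card_Iio] at this
    omega

theorem append_mem_iff (T : PlaneTree D) (v : List (Fin D)) (i : Fin D) :
    v ++ [i] ∈ T.verts ↔ (i : ℕ) < T.deg v :=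
  setOf_lt_of_lower (s := {i | v ++ [i] ∈ T.verts}) (fun i j => T.sibling_mem v i j) i

theorem deg_le (T : PlaneTree D) (v : List (Fin D)) : T.deg v ≤ D := by
  have := Set.ncard_le_ncard (Set.subset_univ {i : Fin D | v ++ [i] ∈ T.verts})
  simpa [deg, Set.ncard_univ] using this

theorem ncard_setOf_val_lt {d : ℕ} (hd : d ≤ D) : {i : Fin D | (i : ℕ) < d}.ncard = d := by
  rw [Set.ncard_eq_toFinset_card']
  simp [Fin.card_filter_val_lt, hd]

theorem deg_eq_of_forall (T : PlaneTree D) (v : List (Fin D)) {d : ℕ} (hd : d ≤ D)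
    (h : ∀ i : Fin D, v ++ [i] ∈ T.verts ↔ (i : ℕ) < d) : T.deg v = d := by
  rw [deg]
  simp only [h]
  exact ncard_setOf_val_lt hd

/-- A partially explored tree: the finite set `I` of explored vertices, whose numbers of children
are given by `d`, and the finite set `A` of their children that have not been explored yet. -/
structure IsExploration (I A : Finset (List (Fin D))) (d : List (Fin D) → ℕ) : Prop where
  disjoint : Disjoint I A
  root_mem : [] ∈ I ∨ [] ∈ A
  child_iff : ∀ v ∈ I, ∀ j : Fin D, v ++ [j] ∈ I ∨ v ++ [j] ∈ A ↔ (j : ℕ) < d v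
  parent_mem : ∀ v, ∀ j : Fin D, v ++ [j] ∈ I ∨ v ++ [j] ∈ A → v ∈ I
  le : ∀ v ∈ I, d v ≤ D

/-- `T` is compatible with the partially explored tree `I`, `A`, `d`. -/
def HasOffspring (I A : Finset (List (Fin D))) (d : List (Fin D) → ℕ) (T : PlaneTree D) : Prop :=
  (∀ v ∈ I, v ∈ T.verts ∧ T.deg v = d v) ∧ ∀ v ∈ A, v ∈ T.verts

/-- The first `i` children of `v`. -/
def children (v : List (Fin D)) (i : ℕ) : Finset (List (Fin D)) :=
  (Finset.univ.filter fun j : Fin D => (j : ℕ) < i).image fun j => v ++ [j]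

theorem mem_children {v u : List (Fin D)} {i : ℕ} :
    u ∈ children v i ↔ ∃ j : Fin D, (j : ℕ) < i ∧ v ++ [j] = u := by
  simp [children]

theorem append_mem_children {v u : List (Fin D)} {i : ℕ} {j : Fin D} :
    u ++ [j] ∈ children v i ↔ u = v ∧ (j : ℕ) < i := by
  rw [mem_children]
  constructor
  · rintro ⟨k, hk, h⟩
    have := List.append_inj' h rfl
    simp at this
    exact ⟨this.1.symm, this.2 ▸ hk⟩
  · rintro ⟨rfl, h⟩
    exact ⟨j, h, rfl⟩

theorem card_children (v : List (Fin D)) {i : ℕ} (hi : i ≤ D) : (children v i).card = i := by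
  rw [children, Finset.card_image_of_injective _ (fun a b h => by simpa using h)]
  simp [Fin.card_filter_val_lt, hi]

namespace IsExploration

variable {I A : Finset (List (Fin D))} {d : List (Fin D) → ℕ}

/-- One exploration step, the counterpart for trees of the recursion defining `forestWeight`. -/
theorem explore (h : IsExploration I A d) {a : List (Fin D)} (ha : a ∈ A) {i : ℕ} (hi : i ≤ D) :
    IsExploration (insert a I) (A.erase a ∪ children a i) (Function.update d a i) where
  disjoint := by
    rw [Finset.disjoint_left]
    intro v hv hv'
    have haI : a ∉ I := fun h' => Finset.disjoint_left.1 h.disjoint h' ha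
    simp only [Finset.mem_insert, Finset.mem_union, Finset.mem_erase] at hv hv'
    rcases hv' with hv' | hv'
    · rcases hv with hv | hv
      · exact hv'.1 hv
      · exact Finset.disjoint_left.1 h.disjoint hv hv'.2
    · obtain ⟨j, _, rfl⟩ := mem_children.1 hv'
      rcases hv with hv | hv
      · simpa using congrArg List.length hv
      · exact haI (h.parent_mem a j (Or.inl hv))
  root_mem := by
    rcases h.root_mem with h' | h'
    · simp [h']
    · by_cases he : [] = a
      · simp [he]
      · simp [h', he]
  child_iff := by
    intro v hv j
    have haI : a ∉ I := fun h' => Finset.disjoint_left.1 h.disjoint h' ha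
    have hne : v ++ [j] ∈ insert a I ∨ v ++ [j] ∈ A.erase a ∪ children a i ↔
        (v ++ [j] ∈ I ∨ v ++ [j] ∈ A) ∨ v ++ [j] ∈ children a i := by
      simp only [Finset.mem_insert, Finset.mem_union, Finset.mem_erase]
      by_cases he : v ++ [j] = a
      · simp [he, ha]
      · simp only [he, false_or, not_false_eq_true, true_and, ne_eq, or_assoc]
    rw [hne, append_mem_children]
    by_cases hva : v = a
    · subst hva
      have : ¬ (v ++ [j] ∈ I ∨ v ++ [j] ∈ A) := fun h' => haI (h.parent_mem v j h')
      simp [this]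
    · rw [Function.update_of_ne hva, ← h.child_iff v (by simpa [hva] using hv) j]
      simp [hva]
  parent_mem := by
    intro v j hv
    simp only [Finset.mem_insert, Finset.mem_union, Finset.mem_erase, append_mem_children] at hv ⊢
    rcases hv with (hv | hv) | (hv | hv)
    · exact Or.inr (h.parent_mem v j (Or.inr (hv ▸ ha)))
    · exact Or.inr (h.parent_mem v j (Or.inl hv))
    · exact Or.inr (h.parent_mem v j (Or.inr hv.2))
    · exact Or.inl hv.1
  le := by
    intro v hv
    by_cases hva : v = a
    · subst hva; simpa using hi
    · rw [Function.update_of_ne hva]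
      exact h.le v (by simpa [hva] using hv)

theorem card_erase_union_children (h : IsExploration I A d) {a : List (Fin D)} (ha : a ∈ A) {i : ℕ}
    (hi : i ≤ D) : (A.erase a ∪ children a i).card = A.card - 1 + i := by
  rw [Finset.card_union_of_disjoint, Finset.card_erase_of_mem ha, card_children a hi]
  rw [Finset.disjoint_left]
  intro v hv hv'
  obtain ⟨j, _, rfl⟩ := mem_children.1 hv'
  exact Finset.disjoint_left.1 h.disjoint (h.parent_mem a j (Or.inr (Finset.mem_of_mem_erase hv))) ha

theorem hasOffspring_explore_iff (h : IsExploration I A d) {a : List (Fin D)} (ha : a ∈ A) (i : ℕ)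
    (T : PlaneTree D) :
    HasOffspring (insert a I) (A.erase a ∪ children a i) (Function.update d a i) T ↔
      HasOffspring I A d T ∧ T.deg a = i := by
  have haI : ∀ v ∈ I, v ≠ a := fun v hv h' => Finset.disjoint_left.1 h.disjoint hv (h' ▸ ha)
  constructor
  · rintro ⟨h1, h2⟩
    have h3 := h1 a (by simp)
    refine ⟨⟨fun v hv => ?_, fun v hv => ?_⟩, by simpa using h3.2⟩
    · have := h1 v (by simp [hv])
      rwa [Function.update_of_ne (haI v hv)] at this
    · by_cases hva : v = a
      · exact hva ▸ h3.1
      · exact h2 v (by simp [hva, hv])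
  · rintro ⟨⟨h1, h2⟩, h3⟩
    refine ⟨fun v hv => ?_, fun v hv => ?_⟩
    · by_cases hva : v = a
      · subst hva; simpa using ⟨h2 v ha, h3⟩
      · rw [Function.update_of_ne hva]
        exact h1 v (by simpa [hva] using hv)
    · rcases Finset.mem_union.1 hv with hv | hv
      · exact h2 v (Finset.mem_of_mem_erase hv)
      · obtain ⟨j, hj, rfl⟩ := mem_children.1 hv
        rw [append_mem_iff, h3]
        exact hj

/-- The tree consisting of the known vertices. -/
def toTree (h : IsExploration I A d) : PlaneTree D where
  verts := {v | v ∈ I ∨ v ∈ A}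
  root_mem := h.root_mem
  parent_mem v i hv := Or.inl (h.parent_mem v i hv)
  sibling_mem v i j hv hj := by
    have hI := h.parent_mem v i hv
    exact (h.child_iff v hI j).2 (lt_of_le_of_lt hj ((h.child_iff v hI i).1 hv))

theorem hasOffspring_toTree (h : IsExploration I A d) : HasOffspring I A d h.toTree :=
  ⟨fun v hv => ⟨Or.inl hv, deg_eq_of_forall _ _ (h.le v hv) (h.child_iff v hv)⟩,
    fun _ hv => Or.inr hv⟩

theorem subset_verts {T : PlaneTree D} (hT : HasOffspring I A d T) :
    ((I ∪ A : Finset _) : Set (List (Fin D))) ⊆ T.verts := by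
  intro v hv
  rcases Finset.mem_union.1 (Finset.mem_coe.1 hv) with hv | hv
  · exact (hT.1 v hv).1
  · exact hT.2 v hv

/-- Descend from the root: with nothing pending, every child of an explored vertex is itself
explored. -/
theorem verts_eq (h : IsExploration I ∅ d) {T : PlaneTree D} (hT : HasOffspring I ∅ d T) :
    T.verts = I := by
  refine Set.Subset.antisymm (fun v => ?_) (fun v hv => (hT.1 v hv).1)
  induction v using List.reverseRecOn with
  | nil => intro _; simpa using h.root_mem
  | append_singleton v j ih =>
    intro hv
    have hI : v ∈ I := ih (T.parent_mem v j hv)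
    rw [append_mem_iff, (hT.1 v hI).2] at hv
    simpa using (h.child_iff v hI j).2 hv

end IsExploration

/-- The product of the weights of the vertices. -/
noncomputable def weight (w : ℕ → ℝ) (T : PlaneTree D) : ℝ := ∏ᶠ v ∈ T.verts, w (T.deg v)

theorem mem_ofOrder {N : ℕ} {T : PlaneTree D} : T ∈ ofOrder D N ↔ T.verts.encard = N := by
  simp [ofOrder]

open Classical in
-- The unexplored part is a forest with `m` vertices and one tree rooted at each pending vertex.
-- Exploring a pending vertex and sorting the trees by its degree reproduces the recursion of
-- `forestWeight`.
theorem IsExploration.sum_weight {I A : Finset (List (Fin D))} {d : List (Fin D) → ℕ}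
    (h : IsExploration I A d) (w : ℕ → ℝ) (m : ℕ) :
    ∑ T ∈ (ofOrder D (I.card + m)).filter (HasOffspring I A d), weight w T =
      (∏ v ∈ I, w (d v)) * forestWeight w D m A.card := by
  -- The pending vertices belong to the tree, so they must be among the `m` vertices not yet
  -- explored.
  have hempty : ∀ {I A : Finset (List (Fin D))} {d : List (Fin D) → ℕ}, IsExploration I A d →
      A.Nonempty → (ofOrder D (I.card + 0)).filter (HasOffspring I A d) = ∅ := by
    intro I A d h hA
    rw [Finset.filter_eq_empty_iff]
    intro T hT hO
    have h1 := Set.encard_le_encard (IsExploration.subset_verts hO)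
    rw [mem_ofOrder.1 hT, Set.encard_coe_eq_coe_finsetCard,
      Finset.card_union_of_disjoint h.disjoint] at h1
    have h2 : I.card + A.card ≤ I.card + 0 := by exact_mod_cast h1
    have := hA.card_pos
    omega
  have hbase : ∀ {I : Finset (List (Fin D))} {d : List (Fin D) → ℕ}, IsExploration I ∅ d → ∀ m,
      ∑ T ∈ (ofOrder D (I.card + m)).filter (HasOffspring I ∅ d), weight w T =
        (∏ v ∈ I, w (d v)) * forestWeight w D m 0 := by
    intro I d h m
    rcases m with _ | m
    · have : (ofOrder D (I.card + 0)).filter (HasOffspring I ∅ d) = {h.toTree} := by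
        ext T
        rw [Finset.mem_filter, Finset.mem_singleton, mem_ofOrder]
        constructor
        · rintro ⟨_, hT⟩
          apply PlaneTree.ext
          rw [h.verts_eq hT, h.verts_eq h.hasOffspring_toTree]
        · rintro rfl
          refine ⟨?_, h.hasOffspring_toTree⟩
          rw [h.verts_eq h.hasOffspring_toTree]
          simp
      rw [this, Finset.sum_singleton, weight, h.verts_eq h.hasOffspring_toTree,
        finprod_mem_coe_finset, forestWeight, mul_one]
      exact Finset.prod_congr rfl fun v hv => by rw [(h.hasOffspring_toTree.1 v hv).2]
    · rw [forestWeight, mul_zero]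
      refine Finset.sum_eq_zero fun T hT => ?_
      rw [Finset.mem_filter, mem_ofOrder] at hT
      have h1 := hT.1
      rw [h.verts_eq hT.2, Set.encard_coe_eq_coe_finsetCard] at h1
      have h2 : I.card = I.card + (m + 1) := by exact_mod_cast h1
      omega
  induction m generalizing I A d with
  | zero =>
    rcases A.eq_empty_or_nonempty with rfl | hA
    · exact hbase h 0
    · rw [hempty h hA]
      obtain ⟨k, hk⟩ := Nat.exists_eq_succ_of_ne_zero hA.card_pos.ne'
      rw [hk, forestWeight]
      simp
  | succ m ih =>
    rcases A.eq_empty_or_nonempty with rfl | hA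
    · exact hbase h (m + 1)
    · obtain ⟨a, ha⟩ := hA
      have haI : a ∉ I := fun h' => Finset.disjoint_left.1 h.disjoint h' ha
      obtain ⟨k, hk⟩ := Nat.exists_eq_succ_of_ne_zero (Finset.card_pos.2 ⟨a, ha⟩).ne'
      rw [hk, forestWeight, Finset.mul_sum, ← Finset.sum_fiberwise_of_maps_to
        (t := Finset.range (D + 1)) (g := fun T : PlaneTree D => T.deg a)
        (fun T _ => by simpa [Nat.lt_succ_iff] using T.deg_le a)]
      refine Finset.sum_congr rfl fun i hi => ?_
      have hi' : i ≤ D := by simpa [Nat.lt_succ_iff] using hi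
      have := ih (h.explore ha hi')
      rw [Finset.card_insert_of_notMem haI, h.card_erase_union_children ha hi',
        Finset.prod_insert haI, hk, add_right_comm, add_assoc, Finset.filter_filter] at *
      simp only [← h.hasOffspring_explore_iff ha]
      rw [Nat.succ_eq_add_one, Nat.add_sub_cancel] at this
      have hprod : ∏ v ∈ I, w (Function.update d a i v) = ∏ v ∈ I, w (d v) :=
        Finset.prod_congr rfl fun v hv => by
          rw [Function.update_of_ne (fun h' : v = a => haI (h' ▸ hv))]
      rw [this, Function.update_self, hprod]
      ring

end PlaneTree

/-! ### Gibbs probabilities of neighbourhoods of the root -/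

namespace PlaneTree

variable {D : ℕ}

theorem measurableSet_mem_verts (v : List (Fin D)) : MeasurableSet {T : PlaneTree D | v ∈ T.verts} :=
  measurableSet_setOfPred.2 (measurable_set_iff.1 (comap_measurable PlaneTree.verts) v)

theorem deg_eq_iff (T : PlaneTree D) (v : List (Fin D)) {d : ℕ} (hd : d ≤ D) :
    T.deg v = d ↔ ∀ j : Fin D, v ++ [j] ∈ T.verts ↔ (j : ℕ) < d :=
  ⟨fun h j => h ▸ T.append_mem_iff v j, T.deg_eq_of_forall v hd⟩

theorem finite_verts_of_mem_ofOrder {N : ℕ} {T : PlaneTree D} (hT : T ∈ ofOrder D N) :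
    T.verts.Finite := Set.finite_of_encard_eq_coe (mem_ofOrder.1 hT)

/-- Every vertex except the root is counted once, as a child of its parent. -/
theorem sum_deg_add_one {T : PlaneTree D} (hT : T.verts.Finite) :
    ∑ v ∈ hT.toFinset, T.deg v + 1 = hT.toFinset.card := by
  classical
  have hroot : [] ∈ hT.toFinset := by simpa using T.root_mem
  rw [← Finset.card_erase_add_one hroot, Finset.card_eq_sum_card_fiberwise (f := List.dropLast)
    (t := hT.toFinset)]
  · congr 1
    refine Finset.sum_congr rfl fun v _ => ?_
    have : (hT.toFinset.erase []).filter (fun u => u.dropLast = v) = children v (T.deg v) := by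
      ext u
      rw [mem_children]
      simp only [Finset.mem_filter, Finset.mem_erase, Set.Finite.mem_toFinset]
      constructor
      · rintro ⟨⟨h1, h2⟩, rfl⟩
        have := List.dropLast_append_getLast h1
        exact ⟨u.getLast h1, by rw [← append_mem_iff, this]; exact h2, this⟩
      · rintro ⟨j, hj, rfl⟩
        rw [← append_mem_iff] at hj
        simp [hj]
    rw [this, card_children v (T.deg_le v)]
  · intro u hu
    simp only [Finset.coe_erase, Set.Finite.coe_toFinset, Set.mem_sdiff, Set.mem_singleton_iff] at hu
    simp only [Set.Finite.coe_toFinset]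
    have := List.dropLast_append_getLast hu.2
    exact T.parent_mem _ (u.getLast hu.2) (by rw [this]; exact hu.1)

/-- The exponents of `ρ` add up to `N - 1`; the extra factor `ρ` on the left avoids the subtraction.
-/
theorem weight_tiltedWeight (E : ℕ → ℝ) (β C ρ : ℝ) {N : ℕ} {T : PlaneTree D}
    (hT : T ∈ ofOrder D N) :
    ρ * weight (tiltedWeight E β C ρ) T = (C * ρ) ^ N * Real.exp (-β * T.energy E) := by
  have hf := finite_verts_of_mem_ofOrder hT
  have hN : hf.toFinset.card = N := by
    have := mem_ofOrder.1 hT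
    rw [← hf.coe_toFinset, Set.encard_coe_eq_coe_finsetCard] at this
    exact_mod_cast this
  rw [weight, energy, finprod_mem_eq_finite_toFinset_prod _ hf,
    finsum_mem_eq_finite_toFinset_sum _ hf, Finset.mul_sum, Real.exp_sum]
  simp only [tiltedWeight, Finset.prod_mul_distrib, Finset.prod_const, Finset.prod_pow_eq_pow_sum]
  rw [hN, mul_pow, show ρ ^ N = ρ ^ (∑ v ∈ hf.toFinset, T.deg v + 1) by
    rw [sum_deg_add_one hf, hN]]
  ring

open Classical in
-- The Gibbs weights and the product weights differ by the constant `(C ρ) ^ N / ρ`, which cancels: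
-- the Gibbs measure is a conditioned Galton–Watson tree.
theorem gibbs_real_apply {E : ℕ → ℝ} {β C ρ : ℝ} (hC : 0 < C) (hρ : 0 < ρ) (N : ℕ)
    {S : Set (PlaneTree D)} (hS : MeasurableSet S) :
    (gibbs D E β N).real S =
      (∑ T ∈ (ofOrder D N).filter (· ∈ S), weight (tiltedWeight E β C ρ) T) /
        ∑ T ∈ ofOrder D N, weight (tiltedWeight E β C ρ) T := by
  have hk : 0 < (C * ρ) ^ N / ρ := by positivity
  have hw : ∀ T ∈ ofOrder D N, weight (tiltedWeight E β C ρ) T =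
      (C * ρ) ^ N / ρ * Real.exp (-β * T.energy E) := by
    intro T hT
    have := weight_tiltedWeight E β C ρ hT
    rw [div_mul_eq_mul_div, eq_div_iff hρ.ne', ← this, mul_comm]
  rw [Finset.sum_congr rfl hw, Finset.sum_congr rfl fun T hT => hw T (Finset.mem_filter.1 hT).1,
    ← Finset.mul_sum, ← Finset.mul_sum, mul_div_mul_left _ _ hk.ne']
  rw [Measure.real, gibbs, Measure.finsetSum_apply, ENNReal.toReal_sum, Finset.sum_div,
    Finset.sum_filter]
  · refine Finset.sum_congr rfl fun T _ => ?_
    rw [Measure.smul_apply, Measure.dirac_apply' _ hS]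
    by_cases hTS : T ∈ S
    · simp only [hTS, Set.indicator_of_mem, Pi.one_apply, smul_eq_mul, mul_one, if_true]
      rw [ENNReal.toReal_ofReal, partitionFunction]
      exact div_nonneg (Real.exp_pos _).le (Finset.sum_nonneg fun _ _ => (Real.exp_pos _).le)
    · simp [hTS]
  · intro T _
    rw [Measure.smul_apply, Measure.dirac_apply' _ hS]
    exact ENNReal.mul_ne_top (by simp) (by by_cases hTS : T ∈ S <;> simp [hTS])

theorem isExploration_root : IsExploration (D := D) ∅ {[]} (fun _ => 0) where
  disjoint := by simp
  root_mem := by simp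
  child_iff := by simp
  parent_mem := by simp
  le := by simp

theorem sum_weight_ofOrder (w : ℕ → ℝ) (N : ℕ) :
    ∑ T ∈ ofOrder D N, weight w T = forestWeight w D N 1 := by
  classical
  have h := (isExploration_root (D := D)).sum_weight w N
  rw [Finset.filter_true_of_mem] at h
  · simpa using h
  · intro T _
    exact ⟨by simp, by simpa using T.root_mem⟩

theorem measurableSet_hasOffspring {I A : Finset (List (Fin D))} {d : List (Fin D) → ℕ}
    (h : IsExploration I A d) : MeasurableSet {T : PlaneTree D | HasOffspring I A d T} := by
  have : {T : PlaneTree D | HasOffspring I A d T} =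
      (⋂ v ∈ I, ({T | v ∈ T.verts} ∩ ⋂ j : Fin D, {T | v ++ [j] ∈ T.verts ↔ (j : ℕ) < d v})) ∩
        ⋂ v ∈ A, {T | v ∈ T.verts} := by
    ext T
    simp only [HasOffspring, Set.mem_ofPred_eq, Set.mem_inter_iff, Set.mem_iInter]
    refine and_congr (forall₂_congr fun v hv => and_congr Iff.rfl ?_) Iff.rfl
    exact T.deg_eq_iff v (h.le v hv)
  rw [this]
  refine .inter (.biInter (Finset.countable_toSet I) fun v _ => (measurableSet_mem_verts v).inter
    (.iInter fun j => ?_)) (.biInter (Finset.countable_toSet A) fun v _ => measurableSet_mem_verts v)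
  by_cases hj : (j : ℕ) < d v
  · simpa [hj] using measurableSet_mem_verts (v ++ [j])
  · have : {T : PlaneTree D | v ++ [j] ∈ T.verts ↔ (j : ℕ) < d v} =
        {T : PlaneTree D | v ++ [j] ∈ T.verts}ᶜ := by ext T; simp [hj]
    rw [this]
    exact (measurableSet_mem_verts (v ++ [j])).compl

/-- With `N = m + |I|` the probability is the product over `I` times `F(m, |A|) / F(m + |I|, 1)`,
and this quotient tends to `|A|`. -/
theorem tendsto_gibbs_hasOffspring {E : ℕ → ℝ} {β C ρ : ℝ} (hC : 0 < C) (hρ : 0 < ρ)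
    (hw : IsCriticalLaw (tiltedWeight E β C ρ) D) {I A : Finset (List (Fin D))}
    {d : List (Fin D) → ℕ} (h : IsExploration I A d) :
    Tendsto (fun N => (gibbs D E β N).real {T | HasOffspring I A d T}) atTop
      (𝓝 (A.card * ∏ v ∈ I, tiltedWeight E β C ρ (d v))) := by
  classical
  rw [← tendsto_add_atTop_iff_nat I.card]
  have h1 := (hw.tendsto_forestWeight_div A.card I.card).mul_const
    (∏ v ∈ I, tiltedWeight E β C ρ (d v))
  refine h1.congr fun m => ?_
  rw [gibbs_real_apply hC hρ _ (measurableSet_hasOffspring h), sum_weight_ofOrder, add_comm m]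
  have h2 := h.sum_weight (tiltedWeight E β C ρ) m
  simp only [Set.mem_ofPred_eq]
  rw [h2]
  ring

theorem isProbabilityMeasure_gibbs {E : ℕ → ℝ} {β C ρ : ℝ} (hC : 0 < C) (hρ : 0 < ρ) {N : ℕ}
    (h : 0 < forestWeight (tiltedWeight E β C ρ) D N 1) : IsProbabilityMeasure (gibbs D E β N) := by
  have h1 : (gibbs D E β N).real Set.univ = 1 := by
    rw [gibbs_real_apply hC hρ N .univ, sum_weight_ofOrder]
    simp only [Set.mem_univ, Finset.filter_true]
    rw [sum_weight_ofOrder, div_self h.ne']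
  refine ⟨?_⟩
  rw [Measure.real] at h1
  rw [← ENNReal.ofReal_toReal (a := gibbs D E β N Set.univ), h1, ENNReal.ofReal_one]
  intro htop
  rw [htop] at h1
  simp at h1

/-- The vertices of height less than `n`. -/
noncomputable def inner (T : PlaneTree D) (n : ℕ) : Finset (List (Fin D)) :=
  ((List.finite_length_lt (Fin D) n).inter_of_left T.verts).toFinset

/-- The vertices of height `n`. -/
noncomputable def sphere (T : PlaneTree D) (n : ℕ) : Finset (List (Fin D)) :=
  ((List.finite_length_eq (Fin D) n).inter_of_left T.verts).toFinset

theorem mem_inner {T : PlaneTree D} {n : ℕ} {v : List (Fin D)} :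
    v ∈ T.inner n ↔ v ∈ T.verts ∧ v.length < n := by
  simp [inner, and_comm]

theorem mem_sphere {T : PlaneTree D} {n : ℕ} {v : List (Fin D)} :
    v ∈ T.sphere n ↔ v ∈ T.verts ∧ v.length = n := by
  simp [sphere, and_comm]

theorem isExploration_inner_sphere (T : PlaneTree D) (n : ℕ) :
    IsExploration (T.inner n) (T.sphere n) T.deg where
  disjoint := by
    rw [Finset.disjoint_left]
    intro v hv hv'
    have h1 := mem_inner.1 hv
    have h2 := mem_sphere.1 hv'
    omega
  root_mem := by
    simp only [mem_inner, mem_sphere, T.root_mem, true_and, List.length_nil]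
    omega
  child_iff := by
    intro v hv j
    have h1 := (mem_inner.1 hv).2
    rw [← append_mem_iff]
    simp only [mem_inner, mem_sphere, ← and_or_left, List.length_append, List.length_singleton]
    exact and_iff_left (by omega)
  parent_mem := by
    intro v j hv
    simp only [mem_inner, mem_sphere, ← and_or_left, List.length_append, List.length_singleton] at hv
    exact mem_inner.2 ⟨T.parent_mem v j hv.1, by omega⟩
  le := fun v _ => T.deg_le v

theorem mem_ball {T : PlaneTree D} {n : ℕ} {v : List (Fin D)} :
    v ∈ (ball n T).verts ↔ v ∈ T.verts ∧ v.length ≤ n := Iff.rfl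

theorem deg_ball (T : PlaneTree D) {n : ℕ} {v : List (Fin D)} (hv : v.length < n) :
    (ball n T).deg v = T.deg v := by
  refine deg_eq_of_forall _ _ (T.deg_le v) fun j => ?_
  rw [← append_mem_iff, mem_ball]
  exact and_iff_left (by simpa using hv)

theorem ball_ball {m n : ℕ} (h : m ≤ n) (T : PlaneTree D) : ball m (ball n T) = ball m T := by
  ext v
  simp only [mem_ball, and_assoc]
  exact and_congr_right fun _ => by omega

/-- The degrees of the vertices of height less than `n` determine the neighbourhood of radius `n`,
by induction along the path from the root. -/
theorem hasOffspring_inner_sphere_iff (T₀ T : PlaneTree D) (n : ℕ) :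
    HasOffspring (T₀.inner n) (T₀.sphere n) T₀.deg T ↔ ball n T = ball n T₀ := by
  constructor
  · intro h
    ext v
    rw [mem_ball, mem_ball]
    induction v using List.reverseRecOn with
    | nil => simp [T.root_mem, T₀.root_mem]
    | append_singleton v j ih =>
      refine and_congr_left fun hl => ?_
      have hl' : v.length < n := by simpa using hl
      have ih' : v ∈ T.verts ↔ v ∈ T₀.verts := by simpa [hl'.le] using ih
      by_cases hv : v ∈ T₀.verts
      · rw [append_mem_iff, append_mem_iff, (h.1 v (mem_inner.2 ⟨hv, hl'⟩)).2]
      · exact iff_of_false (fun h' => hv (ih'.1 (T.parent_mem v j h')))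
          (fun h' => hv (T₀.parent_mem v j h'))
  · intro h
    have hmem : ∀ v : List (Fin D), v.length ≤ n → v ∈ T₀.verts → v ∈ T.verts := by
      intro v hl hv
      have : v ∈ (ball n T₀).verts := ⟨hv, hl⟩
      rw [← h] at this
      exact this.1
    refine ⟨fun v hv => ?_, fun v hv => ?_⟩
    · have hv' := mem_inner.1 hv
      exact ⟨hmem v hv'.2.le hv'.1, by rw [← deg_ball T hv'.2, h, deg_ball T₀ hv'.2]⟩
    · have hv' := mem_sphere.1 hv
      exact hmem v hv'.2.le hv'.1

end PlaneTree

/-! ### Existence and uniqueness of the limit law -/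

namespace PlaneTree

variable {D : ℕ}

instance : MeasurableSingletonClass (PlaneTree D) := by
  refine ⟨fun t => ?_⟩
  have : {t} = ⋂ v : List (Fin D), {T : PlaneTree D | v ∈ T.verts ↔ v ∈ t.verts} := by
    ext T
    simp only [Set.mem_singleton_iff, Set.mem_iInter, Set.mem_ofPred_eq, PlaneTree.ext_iff,
      Set.ext_iff]
  rw [this]
  refine .iInter fun v => ?_
  by_cases hv : v ∈ t.verts
  · simpa [hv] using measurableSet_mem_verts v
  · have : {T : PlaneTree D | v ∈ T.verts ↔ v ∈ t.verts} = {T : PlaneTree D | v ∈ T.verts}ᶜ := by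
      ext T; simp [hv]
    rw [this]
    exact (measurableSet_mem_verts v).compl

/-- This finiteness makes every event about a neighbourhood measurable and reduces total variation
to finitely many limits. -/
theorem finite_range_ball (n : ℕ) : (Set.range (ball n : PlaneTree D → PlaneTree D)).Finite := by
  refine Set.Finite.of_finite_image (f := PlaneTree.verts)
    ((List.finite_length_le (Fin D) n).finite_subsets.subset ?_) (fun T _ T' _ h => PlaneTree.ext h)
  rintro _ ⟨_, ⟨T, rfl⟩, rfl⟩ v hv
  exact hv.2

theorem measurableSet_preimage_ball (n : ℕ) (S : Set (PlaneTree D)) :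
    MeasurableSet (ball n ⁻¹' S) := by
  rw [← Set.preimage_inter_range]
  exact measurable_ball n ((finite_range_ball n).inter_of_right S).measurableSet

open Classical in
theorem real_preimage_ball (μ : Measure (PlaneTree D)) [IsFiniteMeasure μ] (n : ℕ)
    (S : Set (PlaneTree D)) :
    μ.real (ball n ⁻¹' S) =
      ∑ t ∈ (finite_range_ball n).toFinset.filter (· ∈ S), μ.real (ball n ⁻¹' {t}) := by
  rw [← measureReal_biUnion_finset]
  · congr 1
    ext T
    simp
  · intro t _ t' _ hne
    exact Disjoint.preimage _ (by simpa using hne)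
  · exact fun t _ => measurableSet_preimage_ball n {t}

/-- Events about neighbourhoods form a π-system, since a smaller radius can be read off a larger
one, and they generate the σ-algebra. -/
theorem ext_of_real_preimage_ball {P P' : Measure (PlaneTree D)} [IsProbabilityMeasure P]
    [IsProbabilityMeasure P']
    (h : ∀ n T₀, P.real (ball n ⁻¹' {ball n T₀}) = P'.real (ball n ⁻¹' {ball n T₀})) : P = P' := by
  classical
  refine ext_of_generate_finite {s | ∃ n S, s = ball n ⁻¹' S} ?_ ?_ ?_ (by simp)
  · refine le_antisymm ?_ (MeasurableSpace.generateFrom_le ?_)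
    · have hm : Measurable[MeasurableSpace.generateFrom {s | ∃ n S, s = ball n ⁻¹' S}]
          (PlaneTree.verts : PlaneTree D → Set (List (Fin D))) := by
        refine (@measurable_set_iff _ _ (_) _).2 fun v => ?_
        refine (@measurableSet_setOfPred _ (_) _).1 (MeasurableSpace.measurableSet_generateFrom
          ⟨v.length, {T | v ∈ T.verts}, ?_⟩)
        ext T
        simp [mem_ball]
      exact hm.comap_le
    · rintro _ ⟨n, S, rfl⟩
      exact measurableSet_preimage_ball n S
  · rintro _ ⟨m, S, rfl⟩ _ ⟨n, S', rfl⟩ _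
    refine ⟨max m n, ball m ⁻¹' S ∩ ball n ⁻¹' S', ?_⟩
    ext T
    simp [ball_ball]
  · rintro _ ⟨n, S, rfl⟩
    have : P.real (ball n ⁻¹' S) = P'.real (ball n ⁻¹' S) := by
      rw [real_preimage_ball, real_preimage_ball]
      refine Finset.sum_congr rfl fun t ht => ?_
      obtain ⟨T₀, rfl⟩ : t ∈ Set.range (ball n) := by simpa using (Finset.mem_filter.1 ht).1
      exact h n T₀
    exact (measureReal_eq_measureReal_iff).1 this

/-- Compactness of the space of laws of random trees. -/
theorem exists_isProbabilityMeasure_of_tendsto {μ : ℕ → Measure (PlaneTree D)}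
    (hμ : ∀ᶠ N in atTop, IsProbabilityMeasure (μ N)) :
    ∃ P : Measure (PlaneTree D), IsProbabilityMeasure P ∧ ∀ n S q,
      Tendsto (fun N => (μ N).real (ball n ⁻¹' S)) atTop (𝓝 q) → P.real (ball n ⁻¹' S) = q := by
  classical
  -- Indicator functions embed the trees as a closed subset of a Cantor-type product, so they form a
  -- compact metrizable space.
  let f : PlaneTree D → (List (Fin D) → Bool) := fun T v => decide (v ∈ T.verts)
  let _ : TopologicalSpace (PlaneTree D) := TopologicalSpace.induced f inferInstance
  have hf : Topology.IsEmbedding f := by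
    refine ⟨⟨rfl⟩, fun T T' h => PlaneTree.ext (Set.ext fun v => ?_)⟩
    simpa [f] using congrFun h v
  have hrange : IsClosed (Set.range f) := by
    have : Set.range f = {g | g [] = true} ∩ ((⋂ v, ⋂ i, {g | g (v ++ [i]) = true → g v = true}) ∩
        ⋂ v, ⋂ i, ⋂ j, ⋂ (_ : j ≤ i), {g | g (v ++ [i]) = true → g (v ++ [j]) = true}) := by
      ext g
      simp only [Set.mem_range, Set.mem_inter_iff, Set.mem_iInter, Set.mem_ofPred_eq]
      constructor
      · rintro ⟨T, rfl⟩
        simp only [f, decide_eq_true_eq]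
        exact ⟨T.root_mem, T.parent_mem, fun v i j hj h => T.sibling_mem v i j h hj⟩
      · rintro ⟨h1, h2, h3⟩
        exact ⟨⟨{v | g v = true}, h1, h2, fun v i j h hj => h3 v i j hj h⟩, by ext v; simp [f]⟩
    rw [this]
    have hcl : ∀ v u : List (Fin D), IsClosed {g : List (Fin D) → Bool | g v = true → g u = true} := by
      intro v u
      exact (isClopen_discrete {p : Bool × Bool | p.1 = true → p.2 = true}).1.preimage
        (f := fun g : List (Fin D) → Bool => (g v, g u)) (by fun_prop)
    refine IsClosed.inter ?_ (.inter (isClosed_iInter fun v => isClosed_iInter fun i => hcl _ _)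
      (isClosed_iInter fun v => isClosed_iInter fun i => isClosed_iInter fun j =>
        isClosed_iInter fun _ => hcl _ _))
    exact isClosed_eq (by fun_prop) continuous_const
  have hcompact : CompactSpace (PlaneTree D) := Topology.IsClosedEmbedding.compactSpace ⟨hf, hrange⟩
  have hmetr : TopologicalSpace.MetrizableSpace (PlaneTree D) := hf.metrizableSpace
  have hborel : BorelSpace (PlaneTree D) := by
    have hm : Measurable[MeasurableSpace.comap f inferInstance]
        (PlaneTree.verts : PlaneTree D → Set (List (Fin D))) := by
      refine (@measurable_set_iff _ _ (_) _).2 fun v => ?_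
      have h1 : Measurable[MeasurableSpace.comap f inferInstance] fun T : PlaneTree D => f T v :=
        (measurable_pi_apply v).comp (comap_measurable f)
      have h2 := h1 (measurableSet_singleton true)
      refine (@measurableSet_setOfPred _ (_) _).1 ?_
      convert h2 using 1
      ext T
      simp [f]
    have hm' : Measurable f := by
      refine measurable_pi_iff.2 fun v => measurable_to_bool ?_
      convert measurableSet_mem_verts v using 1
      ext T
      simp [f]
    have heq : (inferInstance : MeasurableSpace (PlaneTree D)) =
        MeasurableSpace.comap f inferInstance := le_antisymm hm.comap_le hm'.comap_le
    refine ⟨heq.trans ?_⟩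
    rw [BorelSpace.measurable_eq (α := List (Fin D) → Bool)]
    exact borel_comap.symm
  -- A neighbourhood depends on finitely many coordinates, so these events are clopen and weak
  -- convergence applies to them.
  have hopen : ∀ n (S : Set (PlaneTree D)), IsClopen (ball n ⁻¹' S) := by
    intro n S
    have hfin : Finite {v : List (Fin D) // v.length ≤ n} := (List.finite_length_le (Fin D) n)
    let r : PlaneTree D → ({v : List (Fin D) // v.length ≤ n} → Bool) := fun T v => f T v
    have hr : Continuous r :=
      continuous_pi fun v => (continuous_apply v.1).comp hf.continuous
    have : ball n ⁻¹' S = r ⁻¹' (r '' (ball n ⁻¹' S)) := by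
      refine (Set.subset_preimage_image _ _).antisymm ?_
      rintro T ⟨T', hT', h⟩
      have : ball n T' = ball n T := by
        ext v
        rw [mem_ball, mem_ball]
        refine and_congr_left fun hv => ?_
        simpa [r, f] using congrFun h ⟨v, hv⟩
      rw [Set.mem_preimage, this] at hT'
      exact hT'
    rw [this]
    exact (isClopen_discrete _).preimage hr
  have hex : ∀ N, ∃ ν : ProbabilityMeasure (PlaneTree D),
      IsProbabilityMeasure (μ N) → (ν : Measure (PlaneTree D)) = μ N := by
    intro N
    by_cases h : IsProbabilityMeasure (μ N)
    · exact ⟨⟨μ N, h⟩, fun _ => rfl⟩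
    · exact ⟨⟨Measure.dirac (isExploration_root (D := D)).toTree, inferInstance⟩,
        fun h' => absurd h' h⟩
  choose ν hν using hex
  -- A limit along an ultrafilter finer than `atTop` exists by compactness and agrees with every
  -- limit along `atTop`.
  let U : Ultrafilter ℕ := Ultrafilter.of atTop
  have hU : (U : Filter ℕ) ≤ atTop := Ultrafilter.of_le atTop
  let P : ProbabilityMeasure (PlaneTree D) := (U.map ν).lim
  have hP : Tendsto ν U (𝓝 P) := (U.map ν).le_nhds_lim
  refine ⟨P, inferInstance, fun n S q hq => ?_⟩
  have h1 := ProbabilityMeasure.tendsto_measure_of_isClopen_of_tendsto hP (hopen n S)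
  have h2 := (NNReal.continuous_coe.tendsto _).comp h1
  refine tendsto_nhds_unique h2 ((hq.mono_left hU).congr' ?_)
  filter_upwards [hU hμ] with N hN
  rw [← hν N hN]
  rfl

/-- The probability of a neighbourhood of the root in the limiting tree. -/
noncomputable def ballWeight (w : ℕ → ℝ) (n : ℕ) (T : PlaneTree D) : ℝ :=
  (T.sphere n).card * ∏ v ∈ T.inner n, w (T.deg v)

section LimitLaw

variable {E : ℕ → ℝ} {β C ρ : ℝ}

theorem tendsto_gibbs_ball (hC : 0 < C) (hρ : 0 < ρ) (hw : IsCriticalLaw (tiltedWeight E β C ρ) D)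
    (n : ℕ) (T₀ : PlaneTree D) :
    Tendsto (fun N => (gibbs D E β N).real (ball n ⁻¹' {ball n T₀})) atTop
      (𝓝 (ballWeight (tiltedWeight E β C ρ) n T₀)) := by
  have := tendsto_gibbs_hasOffspring hC hρ hw (T₀.isExploration_inner_sphere n)
  simp only [hasOffspring_inner_sphere_iff] at this
  exact this

theorem real_preimage_ball_of_isLimitTreeLaw (hC : 0 < C) (hρ : 0 < ρ)
    (hw : IsCriticalLaw (tiltedWeight E β C ρ) D) {P : Measure (PlaneTree D)}
    (hP : IsLimitTreeLaw D E β P) (n : ℕ) (T₀ : PlaneTree D) :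
    P.real (ball n ⁻¹' {ball n T₀}) = ballWeight (tiltedWeight E β C ρ) n T₀ := by
  refine tendsto_nhds_unique ?_ (tendsto_gibbs_ball hC hρ hw n T₀)
  rw [Metric.tendsto_atTop']
  intro ε hε
  obtain ⟨N₀, hN₀⟩ := eventually_atTop.1 (hP.tendsto n (ε / 2) (by positivity))
  refine ⟨N₀, fun N hN => ?_⟩
  have := hN₀ N hN.le {ball n T₀} (measurableSet_singleton _)
  rw [map_measureReal_apply (measurable_ball n) (measurableSet_singleton _),
    map_measureReal_apply (measurable_ball n) (measurableSet_singleton _)] at this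
  rw [Real.dist_eq]
  linarith

theorem eventually_isProbabilityMeasure_gibbs (hC : 0 < C) (hρ : 0 < ρ)
    (hw : IsCriticalLaw (tiltedWeight E β C ρ) D) :
    ∀ᶠ N in atTop, IsProbabilityMeasure (gibbs D E β N) :=
  hw.eventually_forestWeight_pos.mono fun _ hN => isProbabilityMeasure_gibbs hC hρ hN

/-- For every event the difference of probabilities is at most the sum over all neighbourhoods of
the absolute differences, a finite sum of null sequences that does not depend on the event. -/
theorem exists_isLimitTreeLaw (hC : 0 < C) (hρ : 0 < ρ)
    (hw : IsCriticalLaw (tiltedWeight E β C ρ) D) : ∃ P, IsLimitTreeLaw D E β P := by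
  classical
  have hprob := eventually_isProbabilityMeasure_gibbs hC hρ hw
  obtain ⟨P, hP, hlim⟩ := exists_isProbabilityMeasure_of_tendsto hprob
  refine ⟨P, hP, fun n ε hε => ?_⟩
  have hball : ∀ t ∈ (finite_range_ball (D := D) n).toFinset,
      Tendsto (fun N => |(gibbs D E β N).real (ball n ⁻¹' {t}) - P.real (ball n ⁻¹' {t})|) atTop
        (𝓝 0) := by
    intro t ht
    obtain ⟨T₀, rfl⟩ : t ∈ Set.range (ball n) := by simpa using ht
    have h1 := tendsto_gibbs_ball hC hρ hw n T₀
    rw [hlim n _ _ h1]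
    exact (tendsto_iff_norm_sub_tendsto_zero).1 h1
  have hsum := tendsto_finsetSum _ hball
  rw [Finset.sum_const_zero] at hsum
  filter_upwards [hsum.eventually_lt_const hε, hprob] with N hN hNprob A hA
  rw [map_measureReal_apply (measurable_ball n) hA, map_measureReal_apply (measurable_ball n) hA,
    real_preimage_ball, real_preimage_ball, ← Finset.sum_sub_distrib]
  exact (Finset.abs_sum_le_sum_abs _ _).trans ((Finset.sum_le_sum_of_subset_of_nonneg
    (Finset.filter_subset _ _) fun _ _ _ => abs_nonneg _).trans hN.le)

theorem isLimitTreeLaw_unique (hC : 0 < C) (hρ : 0 < ρ)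
    (hw : IsCriticalLaw (tiltedWeight E β C ρ) D) {P P' : Measure (PlaneTree D)}
    (hP : IsLimitTreeLaw D E β P) (hP' : IsLimitTreeLaw D E β P') : P' = P := by
  have := hP.isProbabilityMeasure
  have := hP'.isProbabilityMeasure
  refine ext_of_real_preimage_ball fun n T₀ => ?_
  rw [real_preimage_ball_of_isLimitTreeLaw hC hρ hw hP,
    real_preimage_ball_of_isLimitTreeLaw hC hρ hw hP']

end LimitLaw

end PlaneTree

/-! ### Lexicographic order and level sequences -/

theorem List.append_lt_append_of_length_eq {α : Type*} [LinearOrder α] {a b : List α} (s t : List α)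
    (hl : b.length = a.length) (h : b < a) : b ++ s < a ++ t := by
  induction b generalizing a with
  | nil =>
    have : a = [] := List.length_eq_zero_iff.1 hl.symm
    subst this
    exact absurd h (lt_irrefl _)
  | cons x b ih =>
    rcases a with _ | ⟨y, a⟩
    · simp at hl
    · rw [List.cons_append, List.cons_append, List.cons_lt_cons_iff]
      rw [List.cons_lt_cons_iff] at h
      exact h.imp_right fun h => ⟨h.1, ih (by simpa using hl) h.2⟩

theorem List.dropLast_le_dropLast_of_length_eq {α : Type*} [LinearOrder α] {u v : List α}
    (hl : u.length = v.length) (h : u ≤ v) : u.dropLast ≤ v.dropLast := by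
  by_contra hlt
  rw [not_le] at hlt
  have hu : u ≠ [] := by rintro rfl; simp at hlt
  have hv : v ≠ [] := by rintro rfl; simp at hl; exact hu hl
  have := List.append_lt_append_of_length_eq [v.getLast hv] [u.getLast hu] (by simp [hl]) hlt
  rw [List.dropLast_append_getLast, List.dropLast_append_getLast] at this
  exact absurd h (not_le.2 this)

theorem List.SortedLT.idxOf_le_idxOf {α : Type*} [LinearOrder α] [BEq α] [LawfulBEq α]
    {L : List α} (hL : L.SortedLT) {u v : α} (hu : u ∈ L) (hv : v ∈ L) (h : u ≤ v) : L.idxOf u ≤ L.idxOf v := by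
  by_contra hlt
  rw [not_le] at hlt
  have hu' := List.idxOf_lt_length_iff.2 hu
  have hv' := List.idxOf_lt_length_iff.2 hv
  have := List.pairwise_iff_getElem.1 hL.pairwise _ _ hv' hu' hlt
  rw [List.getElem_idxOf, List.getElem_idxOf] at this
  exact absurd h (not_le.2 this)

/-- A sorted list is determined by the multiplicities of its entries. -/
theorem IsLevel.ext {D : ℕ} {g g' : ℕ → ℕ} (hg : IsLevel D g) (hg' : IsLevel D g')
    (h : ∀ i, i ≠ 0 → Set.ncard {j | g j = i} = Set.ncard {j | g' j = i}) : g = g' := by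
  obtain ⟨⟨k, hk, hmono⟩, _⟩ := hg
  obtain ⟨⟨k', hk', hmono'⟩, _⟩ := hg'
  have hcount : ∀ {g : ℕ → ℕ} {k : ℕ}, (∀ l, g l ≠ 0 ↔ l < k) → ∀ i, i ≠ 0 →
      ((List.range k).map g).count i = Set.ncard {j | g j = i} := by
    intro g k hk i hi
    have : {j | g j = i} = ((Finset.range k).filter fun j => g j = i : Finset ℕ) := by
      ext j
      simp only [Set.mem_ofPred_eq, Finset.coe_filter, Finset.mem_range, ← hk]
      exact ⟨fun h => ⟨by omega, h⟩, fun h => h.2⟩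
    rw [this, Set.ncard_coe_finset, List.count, List.countP_map,
      ← Nat.count_eq_card_filter_range, Nat.count]
    congr 1
  have hzero : ∀ {g : ℕ → ℕ} {k : ℕ}, (∀ l, g l ≠ 0 ↔ l < k) →
      ((List.range k).map g).count 0 = 0 := by
    intro g k hk
    rw [List.count_eq_zero]
    simp [hk]
  have hsorted : ∀ {g : ℕ → ℕ} {k : ℕ}, (∀ l l', l ≤ l' → l' < k → g l ≤ g l') →
      ((List.range k).map g).Pairwise (· ≤ ·) := by
    intro g k hm
    rw [List.pairwise_map]
    refine List.pairwise_lt_range.imp_of_mem ?_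
    intro a b _ hb hab
    exact hm a b hab.le (List.mem_range.1 hb)
  have hperm : ((List.range k).map g).Perm ((List.range k').map g') := by
    rw [List.perm_iff_count]
    intro i
    by_cases hi : i = 0
    · rw [hi, hzero hk, hzero hk']
    · rw [hcount hk i hi, hcount hk' i hi, h i hi]
  have heq := hperm.eq_of_pairwise' (hsorted hmono) (hsorted hmono')
  have hkk : k = k' := by simpa using congrArg List.length heq
  subst hkk
  funext l
  by_cases hl : l < k
  · have := congrArg (fun L => L[l]?) heq
    simpa [hl] using this
  · rw [not_not.1 (mt (hk l).1 hl), not_not.1 (mt (hk' l).1 hl)]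

/-! ### Codes of the levels of a tree -/

namespace PlaneTree

variable {D : ℕ}

theorem mem_level {T : PlaneTree D} {n : ℕ} {v : List (Fin D)} :
    v ∈ T.level n ↔ v ∈ T.verts ∧ v.length = n := by
  simp [level, and_comm]

theorem nodup_level (T : PlaneTree D) (n : ℕ) : (T.level n).Nodup := Finset.sort_nodup _ _

theorem sortedLT_level (T : PlaneTree D) (n : ℕ) : (T.level n).SortedLT := Finset.sortedLT_sort _

theorem toFinset_level (T : PlaneTree D) (n : ℕ) : (T.level n).toFinset = T.sphere n := by
  ext v
  rw [List.mem_toFinset, mem_level, mem_sphere]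

theorem length_level (T : PlaneTree D) (n : ℕ) : (T.level n).length = (T.sphere n).card := by
  rw [← toFinset_level, List.toFinset_card_of_nodup (T.nodup_level n)]

theorem level_ball (T : PlaneTree D) {m n : ℕ} (h : m ≤ n) : (ball n T).level m = T.level m := by
  rw [level, level]
  congr 1
  ext v
  simp only [Finset.mem_filter, Set.Finite.mem_toFinset, Set.mem_ofPred_eq, mem_ball]
  refine and_congr_right fun hv => and_iff_left (by omega)

theorem levelCode_ball (T : PlaneTree D) {m n : ℕ} (h : m ≤ n) :
    levelCode m (ball n T) = levelCode m T := by
  funext l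
  rw [levelCode, levelCode, level_ball T h, level_ball T (by omega : m - 1 ≤ n)]

theorem levelCode_of_lt {T : PlaneTree D} {n l : ℕ} (h : l < (T.level n).length) :
    levelCode n T l = (T.level (n - 1)).idxOf (T.level n)[l].dropLast + 1 := by
  rw [levelCode, List.getElem?_eq_getElem h]

theorem levelCode_of_le {T : PlaneTree D} {n l : ℕ} (h : (T.level n).length ≤ l) :
    levelCode n T l = 0 := by
  rw [levelCode, List.getElem?_eq_none h]

theorem levelCode_ne_zero_iff {T : PlaneTree D} {n l : ℕ} :
    levelCode n T l ≠ 0 ↔ l < (T.level n).length := by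
  by_cases h : l < (T.level n).length
  · simp [levelCode_of_lt h, h]
  · simp [levelCode_of_le (not_lt.1 h), h]

theorem levelSize_levelCode (n : ℕ) (T : PlaneTree D) :
    levelSize (levelCode n T) = (T.level n).length := by
  rw [levelSize]
  simp only [levelCode_ne_zero_iff]
  have : {l | l < (T.level n).length} = (Finset.range (T.level n).length : Set ℕ) := by ext; simp
  rw [this, Set.ncard_coe_finset, Finset.card_range]

theorem dropLast_mem_level {T : PlaneTree D} {n : ℕ} {v : List (Fin D)} (hv : v ∈ T.level (n + 1)) :
    v.dropLast ∈ T.level n := by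
  have h := mem_level.1 hv
  have hne : v ≠ [] := by rintro rfl; simp at h
  refine mem_level.2 ⟨T.parent_mem _ (v.getLast hne) ?_, by simp [h.2]⟩
  rw [List.dropLast_append_getLast]
  exact h.1

theorem levelCode_le (T : PlaneTree D) (n l : ℕ) : levelCode (n + 1) T l ≤ (T.level n).length := by
  by_cases h : l < (T.level (n + 1)).length
  · rw [levelCode_of_lt h]
    exact List.idxOf_lt_length_iff.2 (dropLast_mem_level (List.getElem_mem h))
  · rw [levelCode_of_le (not_lt.1 h)]
    exact Nat.zero_le _

theorem levelPrecedes_levelCode (T : PlaneTree D) (n : ℕ) :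
    LevelPrecedes (levelCode n T) (levelCode (n + 1) T) := fun l => by
  rw [levelSize_levelCode]
  exact T.levelCode_le n l

/-- The positions carrying the number of `v` are those of its children. This is the link between
codes and degrees. -/
theorem ncard_levelCode_eq {T : PlaneTree D} {n : ℕ} {v : List (Fin D)} (hv : v ∈ T.level n) :
    Set.ncard {j | levelCode (n + 1) T j = (T.level n).idxOf v + 1} = T.deg v := by
  rw [← card_children v (T.deg_le v), ← Set.ncard_coe_finset]
  have hlt : ∀ j, levelCode (n + 1) T j = (T.level n).idxOf v + 1 →
      j < (T.level (n + 1)).length := fun j hj => levelCode_ne_zero_iff.1 (by omega)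
  refine Set.ncard_congr (fun j hj => (T.level (n + 1))[j]'(hlt j hj)) ?_ ?_ ?_
  · intro j hj
    have hj' := hlt j hj
    have hmem := List.getElem_mem hj'
    rw [Set.mem_ofPred_eq, levelCode_of_lt hj', Nat.add_right_cancel_iff, Nat.add_sub_cancel] at hj
    rw [List.idxOf_inj (dropLast_mem_level hmem)] at hj
    have h := mem_level.1 hmem
    have hne : (T.level (n + 1))[j] ≠ [] := by
      intro h0
      rw [h0] at h
      simp at h
    rw [Finset.mem_coe, mem_children]
    have hd := List.dropLast_append_getLast hne
    rw [hj] at hd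
    refine ⟨(T.level (n + 1))[j].getLast hne, ?_, hd⟩
    rw [← append_mem_iff, hd]
    exact h.1
  · intro a b _ _ hab
    exact (List.Nodup.getElem_inj_iff (T.nodup_level (n + 1))).1 hab
  · intro u hu
    obtain ⟨i, hi, rfl⟩ := mem_children.1 (Finset.mem_coe.1 hu)
    have hmem : v ++ [i] ∈ T.level (n + 1) :=
      mem_level.2 ⟨(T.append_mem_iff v i).2 hi, by simp [(mem_level.1 hv).2]⟩
    have hlt := List.idxOf_lt_length_iff.2 hmem
    refine ⟨(T.level (n + 1)).idxOf (v ++ [i]), ?_, by simp⟩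
    rw [Set.mem_ofPred_eq, levelCode_of_lt hlt]
    simp

theorem ncard_levelCode_of_lt {T : PlaneTree D} {n i : ℕ} (hi : (T.level n).length < i) :
    Set.ncard {j | levelCode (n + 1) T j = i} = 0 := by
  have : {j | levelCode (n + 1) T j = i} = ∅ := by
    ext j
    have := T.levelCode_le n j
    simp only [Set.mem_ofPred_eq, Set.mem_empty_iff_false, iff_false]
    omega
  rw [this, Set.ncard_empty]

/-- Passing to the parent preserves the lexicographic order within a level, so the code is monotone;
its multiplicities are degrees, hence at most `D`. -/
theorem isLevel_levelCode (T : PlaneTree D) (n : ℕ) : IsLevel D (levelCode (n + 1) T) := by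
  refine ⟨⟨(T.level (n + 1)).length, fun l => levelCode_ne_zero_iff, fun l l' hl hl' => ?_⟩,
    fun i hi => ?_⟩
  · rw [levelCode_of_lt hl', levelCode_of_lt (hl.trans_lt hl')]
    have h1 := List.getElem_mem (hl.trans_lt hl')
    have h2 := List.getElem_mem hl'
    refine Nat.succ_le_succ ((T.sortedLT_level n).idxOf_le_idxOf (dropLast_mem_level h1)
      (dropLast_mem_level h2) ?_)
    refine List.dropLast_le_dropLast_of_length_eq ?_ ?_
    · rw [(mem_level.1 h1).2, (mem_level.1 h2).2]
    · rcases hl.eq_or_lt with rfl | hlt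
      · exact le_rfl
      · exact (List.pairwise_iff_getElem.1 (T.sortedLT_level (n + 1)).pairwise _ _ _ _ hlt).le
  · by_cases h : i ≤ (T.level n).length
    · obtain ⟨k, rfl⟩ := Nat.exists_eq_succ_of_ne_zero hi
      have hv := List.getElem_mem (Nat.lt_of_succ_le h)
      have := ncard_levelCode_eq hv
      rw [(T.nodup_level n).idxOf_getElem] at this
      rw [Nat.succ_eq_add_one, this]
      exact T.deg_le _
    · rw [ncard_levelCode_of_lt (not_le.1 h)]
      exact Nat.zero_le D

/-- Once level `n` is known, the next code and the next neighbourhood both amount to the degrees of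
its vertices. -/
theorem levelCode_eq_iff_ball_eq {T T₁ : PlaneTree D} {n : ℕ} (h : ball n T = ball n T₁) :
    levelCode (n + 1) T = levelCode (n + 1) T₁ ↔ ball (n + 1) T = ball (n + 1) T₁ := by
  have hlevel : T.level n = T₁.level n := by
    rw [← level_ball T le_rfl, h, level_ball T₁ le_rfl]
  constructor
  · intro hc
    ext v
    rw [mem_ball, mem_ball]
    refine and_congr_left fun hl => ?_
    have hsmall : ∀ v : List (Fin D), v.length ≤ n → (v ∈ T.verts ↔ v ∈ T₁.verts) := by
      intro v hv
      have := congrArg (fun T : PlaneTree D => v ∈ T.verts) h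
      simpa [mem_ball, hv] using this
    by_cases hv : v.length ≤ n
    · exact hsmall v hv
    · have hne : v ≠ [] := by rintro rfl; simp at hv
      have hp : v.dropLast.length = n := by rw [List.length_dropLast]; omega
      rw [← List.dropLast_append_getLast hne, append_mem_iff, append_mem_iff]
      by_cases hu : v.dropLast ∈ T.verts
      · have h1 := mem_level.2 ⟨hu, hp⟩
        rw [← ncard_levelCode_eq h1, ← ncard_levelCode_eq (hlevel ▸ h1), hc, hlevel]
      · rw [← append_mem_iff, ← append_mem_iff]
        exact iff_of_false (fun h' => hu (T.parent_mem _ _ h'))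
          (fun h' => hu ((hsmall _ hp.le).2 (T₁.parent_mem _ _ h')))
  · intro hb
    rw [← levelCode_ball T le_rfl, hb, levelCode_ball T₁ le_rfl]

/-- The tree of height at most `n + 1` that agrees with `T` up to height `n` and whose vertices `v`
of height `n` have `δ v` children. -/
def graft (T : PlaneTree D) (n : ℕ) (δ : List (Fin D) → ℕ) : PlaneTree D where
  verts := {u | (u ∈ T.verts ∧ u.length ≤ n) ∨
    ∃ v, ∃ j : Fin D, v ++ [j] = u ∧ v ∈ T.verts ∧ v.length = n ∧ (j : ℕ) < δ v}
  root_mem := Or.inl ⟨T.root_mem, by simp⟩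
  parent_mem := by
    rintro v i (⟨h, hl⟩ | ⟨u, j, he, hu, hl, _⟩)
    · exact Or.inl ⟨T.parent_mem v i h, by simp at hl; omega⟩
    · have := List.append_inj' he rfl
      exact Or.inl ⟨this.1 ▸ hu, by rw [← this.1]; exact hl.le⟩
  sibling_mem := by
    rintro v i j (⟨h, hl⟩ | ⟨u, k, he, hu, hl, hk⟩) hj
    · exact Or.inl ⟨T.sibling_mem v i j h hj, by simpa using hl⟩
    · have := List.append_inj' he rfl
      have h2 : k = i := by simpa using this.2
      subst h2
      exact Or.inr ⟨u, j, by rw [this.1], hu, hl, lt_of_le_of_lt hj hk⟩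

theorem ball_graft (T : PlaneTree D) (n : ℕ) (δ : List (Fin D) → ℕ) :
    ball n (T.graft n δ) = ball n T := by
  ext u
  rw [mem_ball, mem_ball]
  refine and_congr_left fun hl => ⟨?_, fun h => Or.inl ⟨h, hl⟩⟩
  rintro (h | ⟨v, j, rfl, _, h, _⟩)
  · exact h.1
  · simp at hl; omega

theorem deg_graft {T : PlaneTree D} {n : ℕ} {δ : List (Fin D) → ℕ} {v : List (Fin D)}
    (hv : v ∈ T.verts) (hn : v.length = n) (hδ : δ v ≤ D) : (T.graft n δ).deg v = δ v := by
  refine deg_eq_of_forall _ _ hδ fun i => ⟨?_, fun h => Or.inr ⟨v, i, rfl, hv, hn, h⟩⟩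
  rintro (h | ⟨u, j, he, _, _, h⟩)
  · have := h.2
    simp at this; omega
  · have := List.append_inj' he rfl
    have h2 : j = i := by simpa using this.2
    rw [← h2, ← this.1]
    exact h

theorem exists_levelCode_eq {T : PlaneTree D} {n : ℕ} {g' : ℕ → ℕ} (hg' : IsLevel D g')
    (hp : LevelPrecedes (levelCode n T) g') :
    ∃ T₁ : PlaneTree D, ball n T₁ = ball n T ∧ levelCode (n + 1) T₁ = g' := by
  -- Each vertex of level `n` receives as many children as its number occurs in `g'`; codes are then
  -- compared through multiplicities.
  let δ : List (Fin D) → ℕ := fun v => Set.ncard {j | g' j = (T.level n).idxOf v + 1}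
  have hball := T.ball_graft n δ
  have hlevel : (T.graft n δ).level n = T.level n := by
    rw [← level_ball _ le_rfl, hball, level_ball T le_rfl]
  refine ⟨T.graft n δ, hball, (isLevel_levelCode _ n).ext hg' fun i hi => ?_⟩
  by_cases h : i ≤ (T.level n).length
  · obtain ⟨k, rfl⟩ := Nat.exists_eq_succ_of_ne_zero hi
    have hk : k < (T.level n).length := Nat.lt_of_succ_le h
    have hv := List.getElem_mem hk
    have h1 := mem_level.1 hv
    have h2 := ncard_levelCode_eq (T := T.graft n δ) (v := (T.level n)[k]) (by rwa [hlevel])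
    rw [deg_graft h1.1 h1.2 (hg'.2 _ (Nat.succ_ne_zero _)), hlevel] at h2
    simp only [δ] at h2
    rw [(T.nodup_level n).idxOf_getElem] at h2
    exact h2
  · rw [ncard_levelCode_of_lt (by rw [hlevel]; exact not_le.1 h)]
    have : {j | g' j = i} = ∅ := by
      ext j
      have := hp j
      rw [levelSize_levelCode] at this
      simp only [Set.mem_ofPred_eq, Set.mem_empty_iff_false, iff_false]
      omega
    rw [this, Set.ncard_empty]

end PlaneTree

/-! ### Transition probabilities and the Markov property -/

namespace PlaneTree

variable {D : ℕ}

theorem sum_sphere_deg {M : Type*} [AddCommMonoid M] (T : PlaneTree D) (n : ℕ) (f : ℕ → M) :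
    ∑ v ∈ T.sphere n, f (T.deg v) =
      ∑ i ∈ Finset.Icc 1 (T.level n).length, f (Set.ncard {j | levelCode (n + 1) T j = i}) := by
  have hmem : ∀ {v}, v ∈ T.sphere n ↔ v ∈ T.level n := by
    intro v
    rw [← toFinset_level, List.mem_toFinset]
  refine Finset.sum_bij (fun v _ => (T.level n).idxOf v + 1) ?_ ?_ ?_ ?_
  · intro v hv
    rw [Finset.mem_Icc]
    exact ⟨Nat.succ_pos _, List.idxOf_lt_length_iff.2 (hmem.1 hv)⟩
  · intro v hv u _ h
    exact (List.idxOf_inj (hmem.1 hv)).1 (Nat.add_right_cancel h)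
  · intro i hi
    rw [Finset.mem_Icc] at hi
    obtain ⟨k, rfl⟩ := Nat.exists_eq_add_of_le' hi.1
    have hk : k < (T.level n).length := hi.2
    exact ⟨(T.level n)[k], hmem.2 (List.getElem_mem hk), by rw [(T.nodup_level n).idxOf_getElem]⟩
  · intro v hv
    rw [ncard_levelCode_eq (hmem.1 hv)]

theorem sum_deg_sphere (T : PlaneTree D) (n : ℕ) :
    ∑ v ∈ T.sphere n, T.deg v = (T.sphere (n + 1)).card := by
  rw [Finset.card_eq_sum_card_fiberwise (f := List.dropLast) (t := T.sphere n)]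
  · refine Finset.sum_congr rfl fun v hv => ?_
    have : (T.sphere (n + 1)).filter (fun u => u.dropLast = v) = children v (T.deg v) := by
      ext u
      rw [mem_children, Finset.mem_filter, mem_sphere]
      constructor
      · rintro ⟨⟨h1, h2⟩, rfl⟩
        have hne : u ≠ [] := by rintro rfl; simp at h2
        have := List.dropLast_append_getLast hne
        exact ⟨u.getLast hne, by rw [← append_mem_iff, this]; exact h1, this⟩
      · rintro ⟨j, hj, rfl⟩
        rw [← append_mem_iff] at hj
        simp [hj, (mem_sphere.1 hv).2]
    rw [this, card_children v (T.deg_le v)]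
  · intro u hu
    rw [Finset.mem_coe, ← toFinset_level, List.mem_toFinset] at hu ⊢
    exact dropLast_mem_level hu

theorem inner_succ (T : PlaneTree D) (n : ℕ) : T.inner (n + 1) = T.inner n ∪ T.sphere n := by
  ext v
  rw [Finset.mem_union, mem_inner, mem_inner, mem_sphere, ← and_or_left]
  exact and_congr_right fun _ => by omega

/-- The new factors are the weights of the vertices of height `n`. With `r` and `r'` the sizes of
levels `n` and `n + 1`, their powers are `C ^ r ρ ^ r' = ρ ^ (r' - r) (C ρ) ^ r`, and the sphere
sizes contribute `r' / r`. -/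
theorem ballWeight_succ {E : ℕ → ℝ} {β C ρ : ℝ} (hρ : 0 < ρ) (n : ℕ) (T : PlaneTree D) :
    ballWeight (tiltedWeight E β C ρ) (n + 1) T =
      levelTransition D E β ρ (C * ρ) (levelCode n T) (levelCode (n + 1) T) *
        ballWeight (tiltedWeight E β C ρ) n T := by
  classical
  rw [levelTransition, if_pos ⟨T.isLevel_levelCode n, T.levelPrecedes_levelCode n⟩, ballWeight,
    ballWeight, inner_succ, Finset.prod_union (T.isExploration_inner_sphere n).disjoint,
    levelSize_levelCode, levelSize_levelCode, length_level, length_level]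
  rcases (T.sphere n).eq_empty_or_nonempty with h0 | h0
  -- If level `n` is empty, so is the next one, and both sides vanish.
  · have := T.sum_deg_sphere n
    rw [h0, Finset.sum_empty] at this
    simp [h0, ← this]
  · have hk : ((T.sphere n).card : ℝ) ≠ 0 := by
      exact_mod_cast h0.card_pos.ne'
    have hprod : ∏ v ∈ T.sphere n, tiltedWeight E β C ρ (T.deg v) =
        Real.exp (-β * levelEnergy E (levelCode n T) (levelCode (n + 1) T)) *
          ρ ^ (((T.sphere (n + 1)).card : ℤ) - ((T.sphere n).card : ℤ)) *
            (C * ρ) ^ (T.sphere n).card := by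
      have hE : levelEnergy E (levelCode n T) (levelCode (n + 1) T) =
          ∑ v ∈ T.sphere n, E (T.deg v) := by
        rw [levelEnergy, levelSize_levelCode, sum_sphere_deg T n E]
      rw [hE, Finset.mul_sum, Real.exp_sum, zpow_sub₀ hρ.ne', zpow_natCast, zpow_natCast,
        ← sum_deg_sphere, ← Finset.prod_pow_eq_pow_sum]
      simp only [tiltedWeight, Finset.prod_mul_distrib, Finset.prod_const]
      rw [mul_pow]
      field_simp
    rw [hprod]
    field_simp

theorem measurableSet_levelCode_preimage {m n : ℕ} (h : m ≤ n) (S : Set (ℕ → ℕ)) :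
    MeasurableSet (levelCode m ⁻¹' S : Set (PlaneTree D)) := by
  have : (levelCode m ⁻¹' S : Set (PlaneTree D)) = ball n ⁻¹' (levelCode m ⁻¹' S) := by
    ext T
    simp only [Set.mem_preimage, levelCode_ball T h]
  rw [this]
  exact measurableSet_preimage_ball n _

section Transition

variable {E : ℕ → ℝ} {β C ρ : ℝ} {P : Measure (PlaneTree D)}

/-- If `g'` can follow the given level, the event is a single neighbourhood of radius `n + 1`;
otherwise it is empty. -/
theorem real_ball_inter_levelCode (hC : 0 < C) (hρ : 0 < ρ)
    (hw : IsCriticalLaw (tiltedWeight E β C ρ) D) (hP : IsLimitTreeLaw D E β P) (n : ℕ)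
    (T₀ : PlaneTree D) (g' : ℕ → ℕ) :
    P.real (ball n ⁻¹' {ball n T₀} ∩ {T | levelCode (n + 1) T = g'}) =
      levelTransition D E β ρ (C * ρ) (levelCode n T₀) g' * P.real (ball n ⁻¹' {ball n T₀}) := by
  by_cases h : IsLevel D g' ∧ LevelPrecedes (levelCode n T₀) g'
  · obtain ⟨T₁, hb, rfl⟩ := exists_levelCode_eq h.1 h.2
    have hset : ball n ⁻¹' {ball n T₀} ∩ {T | levelCode (n + 1) T = levelCode (n + 1) T₁} =
        ball (n + 1) ⁻¹' {ball (n + 1) T₁} := by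
      ext T
      simp only [Set.mem_inter_iff, Set.mem_preimage, Set.mem_singleton_iff, Set.mem_ofPred_eq]
      rw [← hb]
      constructor
      · rintro ⟨h1, h2⟩
        exact (levelCode_eq_iff_ball_eq h1).1 h2
      · intro h1
        have h2 : ball n T = ball n T₁ := by
          rw [← ball_ball n.le_succ T, h1, ball_ball n.le_succ T₁]
        exact ⟨h2, (levelCode_eq_iff_ball_eq h2).2 h1⟩
    rw [hset, ← levelCode_ball T₀ le_rfl, ← hb, levelCode_ball T₁ le_rfl,
      real_preimage_ball_of_isLimitTreeLaw hC hρ hw hP,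
      real_preimage_ball_of_isLimitTreeLaw hC hρ hw hP, ballWeight_succ hρ]
  · rw [levelTransition, if_neg h, zero_mul]
    have hset : ball n ⁻¹' {ball n T₀} ∩ {T | levelCode (n + 1) T = g'} = ∅ := by
      rw [Set.eq_empty_iff_forall_notMem]
      rintro T ⟨h1, rfl⟩
      refine h ⟨T.isLevel_levelCode n, ?_⟩
      rw [← levelCode_ball T₀ le_rfl, ← Set.mem_singleton_iff.1 h1, levelCode_ball T le_rfl]
      exact T.levelPrecedes_levelCode n
    rw [hset, measureReal_empty]

/-- The factor is the same for all neighbourhoods with code `g` at level `n`, so it comes out of the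
sum. As `S` is otherwise arbitrary, it may record the whole past or only the present. -/
theorem real_preimage_ball_inter_levelCode (hC : 0 < C) (hρ : 0 < ρ)
    (hw : IsCriticalLaw (tiltedWeight E β C ρ) D) (hP : IsLimitTreeLaw D E β P) (n : ℕ)
    {g : ℕ → ℕ} (g' : ℕ → ℕ) {S : Set (PlaneTree D)} (hS : ∀ t ∈ S, levelCode n t = g) :
    P.real (ball n ⁻¹' S ∩ {T | levelCode (n + 1) T = g'}) =
      levelTransition D E β ρ (C * ρ) g g' * P.real (ball n ⁻¹' S) := by
  classical
  have := hP.isProbabilityMeasure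
  have hm : MeasurableSet {T : PlaneTree D | levelCode (n + 1) T = g'} :=
    measurableSet_levelCode_preimage le_rfl {g'}
  have h1 := real_preimage_ball (P.restrict {T | levelCode (n + 1) T = g'}) n S
  simp only [measureReal_restrict_apply (measurableSet_preimage_ball n _)] at h1
  rw [h1, real_preimage_ball P, Finset.mul_sum]
  refine Finset.sum_congr rfl fun t ht => ?_
  obtain ⟨ht, htS⟩ := Finset.mem_filter.1 ht
  obtain ⟨T₀, rfl⟩ : t ∈ Set.range (ball n) := by simpa using ht
  rw [real_ball_inter_levelCode hC hρ hw hP, ← hS _ htS, levelCode_ball T₀ le_rfl]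

theorem cond_real_levelCode (hC : 0 < C) (hρ : 0 < ρ)
    (hw : IsCriticalLaw (tiltedWeight E β C ρ) D) (hP : IsLimitTreeLaw D E β P) (n : ℕ)
    {g : ℕ → ℕ} (g' : ℕ → ℕ) {S : Set (PlaneTree D)} (hS : ∀ t ∈ S, levelCode n t = g)
    (h0 : P (ball n ⁻¹' S) ≠ 0) :
    (P[|ball n ⁻¹' S]).real {T | levelCode (n + 1) T = g'} =
      levelTransition D E β ρ (C * ρ) g g' := by
  have := hP.isProbabilityMeasure
  rw [Measure.real, cond_apply (measurableSet_preimage_ball n S), ENNReal.toReal_mul,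
    ENNReal.toReal_inv, ← Measure.real, ← Measure.real,
    real_preimage_ball_inter_levelCode hC hρ hw hP n g' hS]
  have h1 : P.real (ball n ⁻¹' S) ≠ 0 := (measureReal_ne_zero_iff).2 h0
  field_simp

theorem isMarkovChain_levelCode (hC : 0 < C) (hρ : 0 < ρ)
    (hw : IsCriticalLaw (tiltedWeight E β C ρ) D) (hP : IsLimitTreeLaw D E β P) :
    IsMarkovChain P (fun n T => levelCode n T) (levelTransition D E β ρ (C * ρ)) where
  measurable n S _ := measurableSet_levelCode_preimage le_rfl S
  countable := by
    refine ⟨⋃ n, levelCode n '' Set.range (ball n : PlaneTree D → PlaneTree D),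
      Set.countable_iUnion fun n => ((finite_range_ball n).image _).countable,
      fun n => ae_of_all _ fun T => Set.mem_iUnion.2 ⟨n, ball n T, ⟨T, rfl⟩, ?_⟩⟩
    exact levelCode_ball T le_rfl
  markov n x y h := by
    -- The past up to time `n` is an event about the neighbourhood of radius `n`, so both
    -- conditionings give the same transition probability.
    have h1 : {T : PlaneTree D | ∀ i ≤ n, levelCode i T = x i} =
        ball n ⁻¹' {t | ∀ i ≤ n, levelCode i t = x i} := by
      ext T
      simp only [Set.mem_preimage, Set.mem_ofPred_eq]
      exact forall₂_congr fun i hi => by rw [levelCode_ball T hi]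
    have h2 : {T : PlaneTree D | levelCode n T = x n} = ball n ⁻¹' {t | levelCode n t = x n} := by
      ext T
      simp only [Set.mem_preimage, Set.mem_ofPred_eq, levelCode_ball T le_rfl]
    have h' : P {T : PlaneTree D | levelCode n T = x n} ≠ 0 := fun h0 =>
      h (measure_mono_null (fun T hT => hT n le_rfl) h0)
    rw [h1] at h ⊢
    rw [h2] at h' ⊢
    rw [cond_real_levelCode hC hρ hw hP n y (S := {t | ∀ i ≤ n, levelCode i t = x i})
        (fun t ht => ht n le_rfl) h,
      cond_real_levelCode hC hρ hw hP n y (S := {t | levelCode n t = x n})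
        (fun t ht => ht) h']
  transition n x y h := by
    have h2 : {T : PlaneTree D | levelCode n T = x} = ball n ⁻¹' {t | levelCode n t = x} := by
      ext T
      simp only [Set.mem_preimage, Set.mem_ofPred_eq, levelCode_ball T le_rfl]
    rw [h2] at h ⊢
    exact cond_real_levelCode hC hρ hw hP n y (S := {t | levelCode n t = x}) (fun t ht => ht) h

end Transition

end PlaneTree

theorem theorem8 (D : ℕ) (hD : 2 ≤ D) (E : ℕ → ℝ) (β : ℝ) :
    ∃ (p : Fin (D + 1) → ℝ) (C ρ : ℝ) (P : Measure (PlaneTree D)),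
      (p ∈ meanOneSimplex D ∧
        ∀ q ∈ meanOneSimplex D, q ≠ p → freeEnergy D E β p < freeEnergy D E β q) ∧
      0 < C ∧ 0 < ρ ∧
      (∀ i : Fin (D + 1), p i = C * Real.exp (-β * E i) * ρ ^ (i : ℕ)) ∧
      IsLimitTreeLaw D E β P ∧
      (∀ P' : Measure (PlaneTree D), IsLimitTreeLaw D E β P' → P' = P) ∧
      IsMarkovChain P (fun n T => PlaneTree.levelCode n T)
        (levelTransition D E β ρ (Real.exp (freeEnergy D E β p))) := by
  obtain ⟨C, ρ, hC, hρ, hw⟩ := exists_isCriticalLaw_tiltedWeight hD E β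
  obtain ⟨P, hP⟩ := PlaneTree.exists_isLimitTreeLaw hC hρ hw
  refine ⟨fun i => tiltedWeight E β C ρ i, C, ρ, P,
    ⟨hw.mem_meanOneSimplex, fun q hq hne => freeEnergy_tiltedWeight_lt hC hρ hw hq hne⟩,
    hC, hρ, fun _ => rfl, hP, fun P' hP' => PlaneTree.isLimitTreeLaw_unique hC hρ hw hP hP', ?_⟩
  -- This identifies `σ = exp(J(p))` with `C ρ`.
  rw [freeEnergy_tiltedWeight hC hρ hw, Real.exp_add, Real.exp_log hC, Real.exp_log hρ]
  exact PlaneTree.isMarkovChain_levelCode hC hρ hw hP
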